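/- Let $\ell,h_1,h_2\in\mathbb C$ and let $\mathcal S$ be the smooth projective model of the curve $$\eta^3-\ell^2\eta-729\lambda^5+162h_1\lambda^3-9h_2\lambda=0 ,$$ with its single point at infinity $\infty$ and the involution $\upsilon:(\lambda,\eta)\mapsto(-\lambda,-\eta)$. Write $\equiv$ for linear equivalence of divisors on $\mathcal S$, $\mathrm{Jac}(\mathcal S)=\mathrm{Pic}^0(\mathcal S)$, and $\mathrm{Prym}(\mathcal S,\upsilon)=(1-\upsilon)\,\mathrm{Jac}(\mathcal S)$. For $x=(q_1,q_2,p_1,p_2)\in\mathbb C^4$ with $q_2\ne0$ put $$L_x(\lambda)=\begin{pmatrix}6\lambda q_1&-\tfrac12(3q_1^2+q_2^2)&9\lambda-3p_1\\ 9\lambda^2+3\lambda p_1&-3\lambda q_1-q_2p_2&q_2^2\\ -\tfrac12\lambda(3q_1^2+q_2^2)&9\lambda^2+\frac{\ell^2}{q_2^2}-p_2^2&q_2p_2-3\lambda q_1\end{pmatrix},$$ $$H_1=\tfrac12(p_1^2+p_2^2)+\tfrac16q_1^3+\tfrac12q_1q_2^2-\frac{\ell^2}{2q_2^2},\qquad H_2=\Bigl(p_1p_2+\tfrac12q_1^2q_2+\tfrac16q_2^3\Bigr)^2-\ell^2\Bigl(\frac{p_1^2}{q_2^2}+\tfrac23q_1\Bigr).$$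 Let $\mu\in\mathbb C$ be such that there are three distinct points $Q_i=(\mu,\eta_i)$, $i=1,2,3$, of the affine curve over $\lambda=\mu$, and let $\{\alpha,\beta,\gamma\}=\{1,2,3\}$. The branch of the Bäcklund map $\mathcal B$ fixed by $Q_\alpha=(\mu,\eta^*)$, $\eta^*=\eta_\alpha$, relates $x$ to $\tilde x$ if there are $Y_1,Y_2\in\mathbb C$ such that $L_x(\mu)(1,Y_1,Y_2)^T=\eta^*(1,Y_1,Y_2)^T$ and $L_{\tilde x}(\lambda)M(\lambda|\mu)=M(\lambda|\mu)L_x(\lambda)$ for all $\lambda\in\mathbb C$, where $$M(\lambda|\mu)=\begin{pmatrix}\mu-\lambda&-2Y_2&2Y_1\\ 2Y_1\lambda&2Y_1Y_2-\lambda-\mu&-2Y_1^2\\ 2(Y_2-2Y_1^2)\lambda&2Y_2(Y_2-2Y_1^2)+2Y_1(\lambda+\mu)&-2Y_1(Y_2-2Y_1^2)-\lambda-\mu\end{pmatrix}.$$ Let $H_1(x)=h_1$, $H_2(x)=h_2$, and let $\tilde x$ be the image of $x$ under this branch. Let $\psi,\widetilde\psi$ be any non-zero vectors of rational functions on $\mathcal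 S$ with $L_x(\lambda)\psi=\eta\psi$ and $L_{\tilde x}(\lambda)\widetilde\psi=\eta\widetilde\psi$, and let $\mathcal D=\sum_P\max_i(-\mathrm{ord}_P\psi_i)\,P$ and $\widetilde{\mathcal D}=\sum_P\max_i(-\mathrm{ord}_P\widetilde\psi_i)\,P$ be their pole divisors. Then: 1) $\widetilde{\mathcal D}+Q_\alpha+\upsilon(Q_\beta)+\upsilon(Q_\gamma)\equiv\mathcal D+3\infty$. 2) The shift divisor satisfies $$\widetilde{\mathcal D}-\mathcal D\equiv 3\infty-Q_\alpha-\upsilon(Q_\beta)-\upsilon(Q_\gamma)\equiv\upsilon(Q_\alpha)-Q_\alpha ,$$ and its class lies in $\mathrm{Prym}(\mathcal S,\upsilon)$. Hence this branch of $\mathcal B$ acts on the divisor classes as the translation by one point of $\mathrm{Prym}(\mathcal S,\upsilon)$, the same for all $x$ on the level set $H_1=h_1$, $H_2=h_2$. -/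

import Mathlib

open Polynomial WithZero

namespace HenonHeiles

noncomputable section

/-! ### Points, divisors and the Picard group of a curve, through its function field -/

section Curve

variable (F : Type*) [Field F] [Algebra ℂ F]

/-- A place of `F / ℂ`: a normalized discrete valuation of `F` that is trivial on `ℂ`, written
multiplicatively, so that `v f = exp (-ord f)`. When `F` is the function field of a complex
algebraic curve, these are the points of its smooth projective model. -/
@[ext]
structure Place where
  v : Valuation F ℤᵐ⁰
  surjective : Function.Surjective v
  trivial_on_const : ∀ c : ℂ, c ≠ 0 → v (algebraMap ℂ F c) = 1

/-- Divisors on the smooth projective curve with function field `F`. -/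
abbrev Divisor : Type _ := Place F →₀ ℤ

variable {F}

/-- The divisor consisting of one point. -/
def pt (P : Place F) : Divisor F := Finsupp.single P 1

variable (F) in
/-- The degree of a divisor (all points have degree one over `ℂ`). -/
def degree : Divisor F →+ ℤ := Finsupp.liftAddHom fun _ => AddMonoidHom.id ℤ

variable (F) in
/-- The group of principal divisors `(f) = ∑ ord_P(f) P`, `f ≠ 0`. -/
def principal : AddSubgroup (Divisor F) where
  carrier := {D | ∃ f : F, f ≠ 0 ∧ ∀ P : Place F, P.v f = exp (-(D P))}
  zero_mem' := ⟨1, one_ne_zero, fun P => by simp⟩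
  add_mem' := by
    rintro D E ⟨f, hf, hD⟩ ⟨g, hg, hE⟩
    refine ⟨f * g, mul_ne_zero hf hg, fun P => ?_⟩
    rw [map_mul, hD, hE, ← exp_add, Finsupp.add_apply, neg_add]
  neg_mem' := by
    rintro D ⟨f, hf, hD⟩
    refine ⟨f⁻¹, inv_ne_zero hf, fun P => ?_⟩
    rw [map_inv₀, hD, ← exp_neg, Finsupp.neg_apply]

/-- Linear equivalence of divisors. -/
def LinEquiv (D E : Divisor F) : Prop := D - E ∈ principal F

variable (F) in
/-- The Picard group: divisors modulo linear equivalence. -/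
abbrev Pic : Type _ := Divisor F ⧸ principal F

/-- The class of a divisor. -/
def cls (D : Divisor F) : Pic F := QuotientAddGroup.mk D

variable (F) in
/-- The Jacobian, as the subgroup `Pic⁰` of classes of divisors of degree zero. -/
def Jac : AddSubgroup (Pic F) :=
  (degree F).ker.map (QuotientAddGroup.mk' (principal F))

/-- The action on points of an automorphism of the curve, given by its pull-back `s` on
functions: `ord_{s(P)} f = ord_P (s f)`. -/
def Place.map (s : F ≃ₐ[ℂ] F) (P : Place F) : Place F where
  v := P.v.comap (s : F →+* F)
  surjective := fun y => by
    obtain ⟨x, hx⟩ := P.surjective y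
    exact ⟨s.symm x, by simpa using hx⟩
  trivial_on_const := fun c hc => by
    simpa using P.trivial_on_const c hc

/-- The action of an automorphism of the curve on divisors. -/
def divMap (s : F ≃ₐ[ℂ] F) : Divisor F →+ Divisor F :=
  Finsupp.mapDomain.addMonoidHom (Place.map s)

theorem Place.map_map_symm (s : F ≃ₐ[ℂ] F) (P : Place F) :
    Place.map s (Place.map s.symm P) = P := by
  ext f; simp [Place.map]

theorem Place.map_symm_map (s : F ≃ₐ[ℂ] F) (P : Place F) :
    Place.map s.symm (Place.map s P) = P := by
  ext f; simp [Place.map]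

theorem divMap_apply (s : F ≃ₐ[ℂ] F) (D : Divisor F) (P : Place F) :
    divMap s D P = D (Place.map s.symm P) := by
  have hinj : Function.Injective (Place.map s) :=
    Function.LeftInverse.injective (Place.map_symm_map s)
  have h := Finsupp.mapDomain_apply hinj D (Place.map s.symm P)
  rwa [Place.map_map_symm] at h

theorem principal_le_comap (s : F ≃ₐ[ℂ] F) :
    principal F ≤ (principal F).comap (divMap s) := by
  rintro D ⟨f, hf, hD⟩
  refine ⟨s.symm f, by simpa using hf, fun P => ?_⟩
  rw [divMap_apply, ← hD]
  simp [Place.map]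

/-- The action of an automorphism of the curve on divisor classes. -/
def picMap (s : F ≃ₐ[ℂ] F) : Pic F →+ Pic F :=
  QuotientAddGroup.map (principal F) (principal F) (divMap s) (principal_le_comap s)

/-- The Prym variety of a curve with an involution `s`: the image of `1 - s` on the Jacobian. -/
def Prym (s : F ≃ₐ[ℂ] F) : AddSubgroup (Pic F) :=
  (Jac F).map (AddMonoidHom.id (Pic F) - picMap s)

/-- `D` is the divisor of poles of the projective vector `ψ`: the multiplicity of `D` at `P` is
`max_i (-ord_P ψ_i)`. -/
def IsPoleDivisor (ψ : Fin 3 → F) (D : Divisor F) : Prop :=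
  ∀ P : Place F, P.v (ψ 0) ⊔ P.v (ψ 1) ⊔ P.v (ψ 2) = exp (D P)

end Curve

/-! ### The Hénon--Heiles system -/

/-- Points `(q₁, q₂, p₁, p₂)` of the complexified phase space, where `q₂ ≠ 0`. -/
structure Phase where
  q₁ : ℂ
  q₂ : ℂ
  p₁ : ℂ
  p₂ : ℂ
  q₂_ne_zero : q₂ ≠ 0

/-- The Hamiltonian. -/
def H₁ (l : ℂ) (x : Phase) : ℂ :=
  (x.p₁ ^ 2 + x.p₂ ^ 2) / 2 + x.q₁ ^ 3 / 6 + x.q₁ * x.q₂ ^ 2 / 2 - l ^ 2 / (2 * x.q₂ ^ 2)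

/-- The additional integral. -/
def H₂ (l : ℂ) (x : Phase) : ℂ :=
  (x.p₁ * x.p₂ + x.q₁ ^ 2 * x.q₂ / 2 + x.q₂ ^ 3 / 6) ^ 2
    - l ^ 2 * (x.p₁ ^ 2 / x.q₂ ^ 2 + 2 / 3 * x.q₁)

section Lax

variable {R : Type*} [CommRing R] [Algebra ℂ R]

/-- The Lax matrix `L(t)`, for a spectral parameter `t` in any `ℂ`-algebra. -/
def laxL (l : ℂ) (x : Phase) (t : R) : Matrix (Fin 3) (Fin 3) R :=
  let c : ℂ → R := algebraMap ℂ R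
  !![6 * t * c x.q₁, -c ((3 * x.q₁ ^ 2 + x.q₂ ^ 2) / 2), 9 * t - 3 * c x.p₁;
     9 * t ^ 2 + 3 * t * c x.p₁, -3 * t * c x.q₁ - c (x.q₂ * x.p₂), c (x.q₂ ^ 2);
     -t * c ((3 * x.q₁ ^ 2 + x.q₂ ^ 2) / 2), 9 * t ^ 2 + c (l ^ 2 / x.q₂ ^ 2 - x.p₂ ^ 2),
       c (x.q₂ * x.p₂) - 3 * t * c x.q₁]

end Lax

/-- The intertwining matrix `M(t | μ)` with parameters `Y₁, Y₂`. -/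
def matM (μ Y₁ Y₂ t : ℂ) : Matrix (Fin 3) (Fin 3) ℂ :=
  !![μ - t, -2 * Y₂, 2 * Y₁;
     2 * Y₁ * t, 2 * Y₁ * Y₂ - t - μ, -2 * Y₁ ^ 2;
     2 * (Y₂ - 2 * Y₁ ^ 2) * t, 2 * Y₂ * (Y₂ - 2 * Y₁ ^ 2) + 2 * Y₁ * (t + μ),
       -2 * Y₁ * (Y₂ - 2 * Y₁ ^ 2) - t - μ]

/-- `x'` is the image of `x` under the branch of the Bäcklund transformation with parameter `μ`
that is fixed by the eigenvalue `e` of `L(μ)`: `Y₁, Y₂` are given by the eigenvector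
`(1, Y₁, Y₂)` of `L(μ)` for `e`, and `L'(t) M(t | μ) = M(t | μ) L(t)` identically in `t`. -/
def IsBacklundImage (l μ e : ℂ) (x x' : Phase) : Prop :=
  ∃ Y₁ Y₂ : ℂ,
    (laxL l x μ).mulVec ![1, Y₁, Y₂] = e • ![1, Y₁, Y₂] ∧
    ∀ t : ℂ, laxL l x' t * matM μ Y₁ Y₂ t = matM μ Y₁ Y₂ t * laxL l x t

/-! ### The spectral curve -/

/-- The right-hand side of the equation `η³ - l² η = 729 λ⁵ - 162 h₁ λ³ + 9 h₂ λ`. -/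
def rhs (h₁ h₂ : ℂ) : ℂ[X] := C 729 * X ^ 5 - C (162 * h₁) * X ^ 3 + C (9 * h₂) * X

/-- The equation of the spectral curve, as a polynomial in `η` over `ℂ[λ]`. -/
def curvePoly (l h₁ h₂ : ℂ) : ℂ[X][X] := X ^ 3 - C (C (l ^ 2)) * X - C (rhs h₁ h₂)

theorem natDegree_rhs (h₁ h₂ : ℂ) : (rhs h₁ h₂).natDegree = 5 := by
  unfold rhs; compute_degree!

theorem natDegree_curvePoly (l h₁ h₂ : ℂ) : (curvePoly l h₁ h₂).natDegree = 3 := by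
  unfold curvePoly; compute_degree!

theorem monic_curvePoly (l h₁ h₂ : ℂ) : (curvePoly l h₁ h₂).Monic := by
  unfold curvePoly; monicity!

theorem irreducible_curvePoly (l h₁ h₂ : ℂ) : Irreducible (curvePoly l h₁ h₂) := by
  have hd := natDegree_curvePoly l h₁ h₂
  rw [(monic_curvePoly l h₁ h₂).irreducible_iff_roots_eq_zero_of_degree_le_three
    (by omega) (by omega)]
  refine Multiset.eq_zero_of_forall_notMem fun r hr => ?_
  have h0 : r ^ 3 - C (l ^ 2) * r = rhs h₁ h₂ := by
    have := (mem_roots'.1 hr).2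
    simp only [IsRoot, curvePoly, eval_sub, eval_pow, eval_X, eval_mul, eval_C] at this
    exact sub_eq_zero.1 this
  have h5 := natDegree_rhs h₁ h₂
  rw [← h0] at h5
  rcases Nat.eq_zero_or_pos r.natDegree with hr0 | hr0
  · rw [eq_C_of_natDegree_eq_zero hr0, ← C_pow, ← C_mul, ← C_sub, natDegree_C] at h5
    omega
  · have hlt : (C (l ^ 2) * r).natDegree < (r ^ 3).natDegree := by
      rw [natDegree_pow]
      exact lt_of_le_of_lt (natDegree_C_mul_le _ _) (by omega)
    rw [natDegree_sub_eq_left_of_natDegree_lt hlt, natDegree_pow] at h5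
    omega

/-- The ring of regular functions on the affine spectral curve. -/
abbrev CoordRing (l h₁ h₂ : ℂ) : Type := AdjoinRoot (curvePoly l h₁ h₂)

instance (l h₁ h₂ : ℂ) : IsDomain (CoordRing l h₁ h₂) :=
  AdjoinRoot.isDomain_of_prime (irreducible_curvePoly l h₁ h₂).prime

/-- The function field of the spectral curve `S`; the points of (the smooth projective model of)
`S` are the places of this field. -/
abbrev FunField (l h₁ h₂ : ℂ) : Type := FractionRing (CoordRing l h₁ h₂)

section Spectral

variable (l h₁ h₂ : ℂ)

/-- The coordinate `λ` as a regular function. -/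
def lamA : CoordRing l h₁ h₂ := AdjoinRoot.of (curvePoly l h₁ h₂) X

/-- The coordinate `η` as a regular function. -/
def etaA : CoordRing l h₁ h₂ := AdjoinRoot.root (curvePoly l h₁ h₂)

/-- The coordinate `λ` as a rational function. -/
def lam : FunField l h₁ h₂ := algebraMap (CoordRing l h₁ h₂) (FunField l h₁ h₂) (lamA l h₁ h₂)

/-- The coordinate `η` as a rational function. -/
def eta : FunField l h₁ h₂ := algebraMap (CoordRing l h₁ h₂) (FunField l h₁ h₂) (etaA l h₁ h₂)

theorem aeval_lamA (p : ℂ[X]) :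
    aeval (lamA l h₁ h₂) p = AdjoinRoot.of (curvePoly l h₁ h₂) p := by
  have : aeval (lamA l h₁ h₂) = (AdjoinRoot.ofAlgHom ℂ (curvePoly l h₁ h₂)) := by
    ext; simp [lamA]
  rw [this]; rfl

theorem etaA_eq :
    etaA l h₁ h₂ ^ 3 - algebraMap ℂ _ (l ^ 2) * etaA l h₁ h₂
      - aeval (lamA l h₁ h₂) (rhs h₁ h₂) = 0 := by
  have key : ∀ (B : Type) [CommRing B] (i : ℂ[X] →+* B) (b : B),
      (curvePoly l h₁ h₂).eval₂ i b = b ^ 3 - i (C (l ^ 2)) * b - i (rhs h₁ h₂) := by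
    intro B _ i b
    simp only [curvePoly, eval₂_sub, eval₂_mul, eval₂_pow, eval₂_X, eval₂_C]
  have h := AdjoinRoot.eval₂_root (curvePoly l h₁ h₂)
  rw [key] at h
  rw [aeval_lamA]
  exact h

theorem rhs_neg {A : Type*} [CommRing A] [Algebra ℂ A] (a : A) :
    aeval (-a) (rhs h₁ h₂) = -aeval a (rhs h₁ h₂) := by
  simp only [rhs, map_add, map_sub, map_mul, map_pow, aeval_C, aeval_X]
  ring

/-- The pull-back of regular functions by `(λ, η) ↦ (-λ, -η)`. -/
def upsilonHom : CoordRing l h₁ h₂ →ₐ[ℂ] CoordRing l h₁ h₂ :=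
  AdjoinRoot.liftAlgHom (curvePoly l h₁ h₂) (aeval (-lamA l h₁ h₂)) (-etaA l h₁ h₂) (by
    simp only [curvePoly, eval₂_sub, eval₂_mul, eval₂_pow, eval₂_X, eval₂_C, RingHom.coe_coe,
      rhs_neg, aeval_C]
    linear_combination -(etaA_eq l h₁ h₂))

theorem upsilonHom_lamA : upsilonHom l h₁ h₂ (lamA l h₁ h₂) = -lamA l h₁ h₂ := by
  simp [upsilonHom, lamA]

theorem upsilonHom_etaA : upsilonHom l h₁ h₂ (etaA l h₁ h₂) = -etaA l h₁ h₂ := by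
  simp [upsilonHom, etaA]

theorem upsilonHom_comp :
    (upsilonHom l h₁ h₂).comp (upsilonHom l h₁ h₂) = AlgHom.id ℂ _ := by
  apply AdjoinRoot.algHom_ext'
  · ext
    change upsilonHom l h₁ h₂ (upsilonHom l h₁ h₂ (lamA l h₁ h₂)) = lamA l h₁ h₂
    rw [upsilonHom_lamA, map_neg, upsilonHom_lamA, neg_neg]
  · change upsilonHom l h₁ h₂ (upsilonHom l h₁ h₂ (etaA l h₁ h₂)) = etaA l h₁ h₂
    rw [upsilonHom_etaA, map_neg, upsilonHom_etaA, neg_neg]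

/-- The pull-back of regular functions by `(λ, η) ↦ (-λ, -η)`, as an automorphism. -/
def upsilonA : CoordRing l h₁ h₂ ≃ₐ[ℂ] CoordRing l h₁ h₂ :=
  AlgEquiv.ofAlgHom (upsilonHom l h₁ h₂) (upsilonHom l h₁ h₂)
    (upsilonHom_comp l h₁ h₂) (upsilonHom_comp l h₁ h₂)

/-- The involution `υ : (λ, η) ↦ (-λ, -η)` of `S`, through its pull-back on rational functions. -/
def upsilon : FunField l h₁ h₂ ≃ₐ[ℂ] FunField l h₁ h₂ :=
  IsFractionRing.fieldEquivOfAlgEquiv ℂ _ _ (upsilonA l h₁ h₂)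

theorem upsilon_lam : upsilon l h₁ h₂ (lam l h₁ h₂) = -lam l h₁ h₂ := by
  have h : upsilonA l h₁ h₂ (lamA l h₁ h₂) = -lamA l h₁ h₂ := upsilonHom_lamA l h₁ h₂
  simp [upsilon, lam, h]

theorem upsilon_eta : upsilon l h₁ h₂ (eta l h₁ h₂) = -eta l h₁ h₂ := by
  have h : upsilonA l h₁ h₂ (etaA l h₁ h₂) = -etaA l h₁ h₂ := upsilonHom_etaA l h₁ h₂
  simp [upsilon, eta, h]

/-- `(a, b)` satisfies the equation of the affine spectral curve. -/
def OnCurve (a b : ℂ) : Prop :=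
  b ^ 3 - l ^ 2 * b - 729 * a ^ 5 + 162 * h₁ * a ^ 3 - 9 * h₂ * a = 0

variable {l h₁ h₂}

/-- The point `P` of `S` has affine coordinates `(λ, η) = (a, b)`. -/
def HasCoords (P : Place (FunField l h₁ h₂)) (a b : ℂ) : Prop :=
  P.v (lam l h₁ h₂ - algebraMap ℂ _ a) < 1 ∧ P.v (eta l h₁ h₂ - algebraMap ℂ _ b) < 1

/-- The point `P` of `S` is the point at infinity, i.e. a pole of `λ`. -/
def IsInfinity (P : Place (FunField l h₁ h₂)) : Prop := 1 < P.v (lam l h₁ h₂)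

/-- `D` is the divisor of poles, on `S`, of some eigenvector `ψ` of the Lax matrix of `x`:
`L(λ) ψ(P) = η ψ(P)` for `P = (λ, η)` in `S`. -/
def IsEigenvectorDivisor (x : Phase) (D : Divisor (FunField l h₁ h₂)) : Prop :=
  ∃ ψ : Fin 3 → FunField l h₁ h₂,
    ψ ≠ 0 ∧ (laxL l x (lam l h₁ h₂)).mulVec ψ = eta l h₁ h₂ • ψ ∧ IsPoleDivisor ψ D

end Spectral

end

end HenonHeiles

open HenonHeiles

/-! The relation `L' M = M L` makes `M ψ` an eigenvector of the second Lax matrix for `η`.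
Eigenvectors over the function field are unique up to a factor (`exists_eq_smul_of_eigenvectors`),
so `ψ'` is a multiple of `M ψ`, and only the change of the pole divisor under `M` has to be found
(`vmax_intertwiner`).

`M` is affine in `λ` and has an inverse of the same kind up to the factor `μ² - λ²`
(`cointertwiner_mul_intertwiner`). Hence it changes orders only over `∞` and `λ = ±μ`. At `∞` it
adds a pole of order 3. For `μ ≠ 0`, `M(μ)` has kernel spanned by `(1, Y₁, Y₂)`, the eigenvector at
`Q_α`, which gives a simple zero there and none at the other two points. `M(-μ)` has rank one, and
its row `(μ, -Y₂, Y₁)` is a left eigenvector of `L(-μ)` for `-η_α` (`left_eigenvector`). It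
annihilates the eigenvectors at `υ(Q_β)` and `υ(Q_γ)` but not the one at `υ(Q_α)`. For `μ = 0` the
two fibres coincide and the orders are computed directly, with a double zero at `Q_α` when `η_α ≠
0`. In all cases `M` contributes `3∞ - Q_α - υ(Q_β) - υ(Q_γ)`.

The divisor of `λ + μ` (`linEquiv_fibre`) turns this into `υ(Q_α) - Q_α`, which is `(1 - υ)(∞ -
Q_α)` because `υ` fixes `∞`. This is a Prym class independent of `x`.

Points are valuations, so the local geometry is derived from the equation: `λ - a` is a uniformizer
at unramified points, and the coprime pole orders 3 and 5 of `λ` and `η` determine the place at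
infinity. -/

namespace HenonHeiles

noncomputable section

/-! ### Residues at a place, and the norm of a vector of functions -/

section Residues

variable {F : Type*} [Field F] [Algebra ℂ F] {P : Place F} {f g : F} {a b c : ℂ}

/-- The function `f` is regular at `P` and takes the value `c` there. -/
def Place.Res (P : Place F) (f : F) (c : ℂ) : Prop := P.v (f - algebraMap ℂ F c) < 1

theorem Place.v_const_le (P : Place F) (c : ℂ) : P.v (algebraMap ℂ F c) ≤ 1 := by
  rcases eq_or_ne c 0 with rfl | hc
  · simp
  · exact (P.trivial_on_const c hc).le

theorem Place.res_const (P : Place F) (c : ℂ) : P.Res (algebraMap ℂ F c) c := by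
  simp [Place.Res]

theorem Place.res_zero_iff : P.Res f 0 ↔ P.v f < 1 := by simp [Place.Res]

theorem Place.Res.v_le_one (h : P.Res f a) : P.v f ≤ 1 := by
  have := P.v.map_add (f - algebraMap ℂ F a) (algebraMap ℂ F a)
  rw [sub_add_cancel] at this
  exact this.trans (max_le h.le (P.v_const_le a))

theorem Place.Res.v_eq_one (h : P.Res f a) (ha : a ≠ 0) : P.v f = 1 := by
  have := P.v.map_add_eq_of_lt_left (h.trans_eq (P.trivial_on_const a ha).symm)
  rwa [add_sub_cancel, P.trivial_on_const a ha] at this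

theorem Place.Res.add (hf : P.Res f a) (hg : P.Res g b) : P.Res (f + g) (a + b) := by
  have := P.v.map_add_lt hf hg
  unfold Place.Res
  rwa [map_add, add_sub_add_comm]

theorem Place.Res.neg (hf : P.Res f a) : P.Res (-f) (-a) := by
  unfold Place.Res
  rw [map_neg, ← neg_sub', Valuation.map_neg]
  exact hf

theorem Place.Res.sub (hf : P.Res f a) (hg : P.Res g b) : P.Res (f - g) (a - b) := by
  simpa [sub_eq_add_neg] using hf.add hg.neg

theorem Place.Res.mul (hf : P.Res f a) (hg : P.Res g b) : P.Res (f * g) (a * b) := by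
  have h1 : P.v ((f - algebraMap ℂ F a) * g) < 1 := by
    rw [map_mul]
    exact (mul_le_of_le_one_right' hg.v_le_one).trans_lt hf
  have h2 : P.v (algebraMap ℂ F a * (g - algebraMap ℂ F b)) < 1 := by
    rw [map_mul]
    exact (mul_le_of_le_one_left' (P.v_const_le a)).trans_lt hg
  have := P.v.map_add_lt h1 h2
  unfold Place.Res
  convert this using 2
  rw [map_mul]
  ring

theorem Place.Res.inv (hf : P.Res f a) (ha : a ≠ 0) : P.Res f⁻¹ a⁻¹ := by
  have hf0 : f ≠ 0 := by
    rintro rfl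
    simpa using hf.v_eq_one ha
  have ha' : algebraMap ℂ F a ≠ 0 := by simpa using ha
  unfold Place.Res
  have : f⁻¹ - algebraMap ℂ F a⁻¹ = -((f - algebraMap ℂ F a) * (f⁻¹ * algebraMap ℂ F a⁻¹)) := by
    rw [map_inv₀]
    field_simp
    ring
  rw [this, Valuation.map_neg, map_mul, map_mul, map_inv₀, hf.v_eq_one ha,
    P.trivial_on_const _ (inv_ne_zero ha)]
  simpa [Place.Res] using hf

theorem Place.Res.eq (hf : P.Res f a) (hf' : P.Res f b) : a = b := by
  by_contra hab
  have h := hf.sub hf'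
  rw [sub_self] at h
  simpa using h.v_eq_one (sub_ne_zero.2 hab)

theorem Place.Res.sum {ι : Type*} {s : Finset ι} {f : ι → F} {c : ι → ℂ}
    (h : ∀ i ∈ s, P.Res (f i) (c i)) : P.Res (∑ i ∈ s, f i) (∑ i ∈ s, c i) := by
  classical
  induction s using Finset.induction_on with
  | empty => simpa using P.res_const 0
  | insert i s hi ih =>
    rw [Finset.sum_insert hi, Finset.sum_insert hi]
    exact (h i (by simp)).add (ih fun j hj => h j (by simp [hj]))

theorem Place.Res.aeval (hf : P.Res f a) (p : ℂ[X]) : P.Res (aeval f p) (p.eval a) := by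
  induction p using Polynomial.induction_on' with
  | add p q hp hq => simpa using hp.add hq
  | monomial n c =>
    rw [aeval_monomial, eval_monomial]
    refine (P.res_const c).mul ?_
    induction n with
    | zero => simpa using P.res_const 1
    | succ n ih =>
      rw [pow_succ, pow_succ]
      exact ih.mul hf

theorem Place.v_aeval_le_one (h : P.v f ≤ 1) (p : ℂ[X]) : P.v (Polynomial.aeval f p) ≤ 1 := by
  rw [aeval_eq_sum_range]
  refine P.v.map_sum_le fun i _ => ?_
  rw [Algebra.smul_def, map_mul, map_pow]
  exact mul_le_one' (P.v_const_le _) (pow_le_one' h _)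

theorem Place.Res.mulVec {A : Matrix (Fin 3) (Fin 3) F} {B : Matrix (Fin 3) (Fin 3) ℂ}
    {φ : Fin 3 → F} {u : Fin 3 → ℂ} (hA : ∀ i j, P.Res (A i j) (B i j))
    (hφ : ∀ i, P.Res (φ i) (u i)) (i : Fin 3) : P.Res (A.mulVec φ i) (B.mulVec u i) := by
  simp only [Matrix.mulVec, dotProduct]
  exact Place.Res.sum fun j _ => (hA i j).mul (hφ j)

/-- An element of norm less than one has norm at most `exp (-1)`. -/
theorem le_exp_neg_one {x : ℤᵐ⁰} (h : x < 1) : x ≤ exp (-1) := by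
  rw [← lt_mul_exp_iff_le exp_ne_zero, ← exp_add]
  simpa using h

end Residues

section Norm

variable {F : Type*} [Field F] {v : Valuation F ℤᵐ⁰}

/-- The largest value of the components of a vector. -/
def vmax (v : Valuation F ℤᵐ⁰) (φ : Fin 3 → F) : ℤᵐ⁰ := v (φ 0) ⊔ v (φ 1) ⊔ v (φ 2)

theorem vmax_le_iff {φ : Fin 3 → F} {r : ℤᵐ⁰} : vmax v φ ≤ r ↔ ∀ i, v (φ i) ≤ r := by
  simp [vmax, Fin.forall_fin_succ, and_assoc]

theorem le_vmax (φ : Fin 3 → F) (i : Fin 3) : v (φ i) ≤ vmax v φ := vmax_le_iff.1 le_rfl i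

theorem exists_eq_vmax (v : Valuation F ℤᵐ⁰) (φ : Fin 3 → F) : ∃ i, v (φ i) = vmax v φ := by
  unfold vmax
  rcases max_choice (v (φ 0) ⊔ v (φ 1)) (v (φ 2)) with h | h
  · rcases max_choice (v (φ 0)) (v (φ 1)) with h' | h'
    · exact ⟨0, by rw [h, h']⟩
    · exact ⟨1, by rw [h, h']⟩
  · exact ⟨2, by rw [h]⟩

theorem vmax_smul (c : F) (φ : Fin 3 → F) : vmax v (c • φ) = v c * vmax v φ := by
  refine le_antisymm (vmax_le_iff.2 fun i => ?_) ?_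
  · rw [Pi.smul_apply, smul_eq_mul, map_mul]
    exact mul_le_mul_right (le_vmax φ i) _
  · obtain ⟨i, hi⟩ := exists_eq_vmax v φ
    rw [← hi, ← map_mul]
    exact le_vmax (c • φ) i

theorem vmax_ne_zero {φ : Fin 3 → F} (h : φ ≠ 0) : vmax v φ ≠ 0 := by
  intro h0
  apply h
  funext i
  have := le_vmax (v := v) φ i
  rw [h0] at this
  simpa using this

theorem vmax_mulVec_le {A : Matrix (Fin 3) (Fin 3) F} {r : ℤᵐ⁰} (hA : ∀ i j, v (A i j) ≤ r)
    (φ : Fin 3 → F) : vmax v (A.mulVec φ) ≤ r * vmax v φ := by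
  refine vmax_le_iff.2 fun i => ?_
  simp only [Matrix.mulVec, dotProduct]
  refine v.map_sum_le fun j _ => ?_
  rw [map_mul]
  exact mul_le_mul' (hA i j) (le_vmax φ j)

/-- An inverse up to the scalar `d` limits how much `A` can shrink a vector; every lower bound on `M
φ` obtained from the cointertwiner comes from here. -/
theorem vmax_le_mulVec {A B : Matrix (Fin 3) (Fin 3) F} {r : ℤᵐ⁰} {d : F}
    (hB : ∀ i j, v (B i j) ≤ r) (h : B * A = d • 1) (φ : Fin 3 → F) :
    v d * vmax v φ ≤ r * vmax v (A.mulVec φ) := by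
  have := vmax_mulVec_le hB (A.mulVec φ)
  rwa [Matrix.mulVec_mulVec, h, Matrix.smul_mulVec, Matrix.one_mulVec, vmax_smul] at this

/-- A nonzero vector has a multiple of norm one. -/
theorem exists_normalized (v : Valuation F ℤᵐ⁰) {ψ : Fin 3 → F} (h : ψ ≠ 0) :
    ∃ c : F, c ≠ 0 ∧ vmax v (c • ψ) = 1 := by
  obtain ⟨i, hi⟩ := exists_eq_vmax v ψ
  have h0 : v (ψ i) ≠ 0 := hi ▸ vmax_ne_zero h
  refine ⟨(ψ i)⁻¹, inv_ne_zero (by simpa using h0), ?_⟩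
  rw [vmax_smul, ← hi, map_inv₀, inv_mul_cancel₀ h0]

end Norm

section NormRes

variable {F : Type*} [Field F] [Algebra ℂ F] {P : Place F}

theorem vmax_eq_one_of_res {φ : Fin 3 → F} {u : Fin 3 → ℂ} (h : ∀ i, P.Res (φ i) (u i))
    (hu : u ≠ 0) : vmax P.v φ = 1 := by
  obtain ⟨i, hi⟩ := Function.ne_iff.1 hu
  refine le_antisymm (vmax_le_iff.2 fun j => (h j).v_le_one) ?_
  rw [← (h i).v_eq_one hi]
  exact le_vmax φ i

theorem vmax_le_exp_neg_one_of_res {φ : Fin 3 → F} {u : Fin 3 → ℂ}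
    (h : ∀ i, P.Res (φ i) (u i)) (hu : u = 0) : vmax P.v φ ≤ exp (-1) := by
  refine vmax_le_iff.2 fun j => le_exp_neg_one (Place.res_zero_iff.1 ?_)
  simpa [hu] using h j

end NormRes

/-! ### The points of the spectral curve -/

section Points

variable {l h₁ h₂ : ℂ} {P P' : Place (FunField l h₁ h₂)} {a b : ℂ}

theorem eta_eq :
    eta l h₁ h₂ ^ 3 - algebraMap ℂ _ (l ^ 2) * eta l h₁ h₂ = aeval (lam l h₁ h₂) (rhs h₁ h₂) := by
  have h := congrArg (algebraMap (CoordRing l h₁ h₂) (FunField l h₁ h₂)) (etaA_eq l h₁ h₂)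
  rw [map_zero, map_sub, map_sub, map_mul, map_pow, ← aeval_algebraMap_apply,
    ← IsScalarTower.algebraMap_apply] at h
  exact sub_eq_zero.1 h

theorem algebraMap_mk (p : ℂ[X][X]) :
    algebraMap (CoordRing l h₁ h₂) (FunField l h₁ h₂) (AdjoinRoot.mk _ p) =
      p.eval₂ (aeval (lam l h₁ h₂) : ℂ[X] →ₐ[ℂ] FunField l h₁ h₂) (eta l h₁ h₂) := by
  induction p using Polynomial.induction_on' with
  | add p q hp hq => simp [hp, hq]
  | monomial n c =>
    rw [eval₂_monomial, ← C_mul_X_pow_eq_monomial, map_mul, map_pow, map_mul, map_pow,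
      AdjoinRoot.mk_C, AdjoinRoot.mk_X, ← aeval_lamA, ← aeval_algebraMap_apply]
    rfl

/-- Evaluation of regular functions at a point of the affine curve. -/
def evalAt (h : OnCurve l h₁ h₂ a b) : CoordRing l h₁ h₂ →ₐ[ℂ] ℂ :=
  AdjoinRoot.liftAlgHom (curvePoly l h₁ h₂) (aeval a) b (by
    simp only [curvePoly, eval₂_sub, eval₂_mul, eval₂_pow, eval₂_X, eval₂_C, RingHom.coe_coe]
    simp only [rhs, map_add, map_sub, map_mul, map_pow, aeval_C, aeval_X, Algebra.algebraMap_self,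
      RingHom.id_apply]
    unfold OnCurve at h
    linear_combination h)

theorem evalAt_mk (h : OnCurve l h₁ h₂ a b) (p : ℂ[X][X]) :
    evalAt h (AdjoinRoot.mk _ p) = p.eval₂ (aeval a : ℂ[X] →ₐ[ℂ] ℂ) b := by
  simp [evalAt]

theorem HasCoords.res_lam (hP : HasCoords P a b) : P.Res (lam l h₁ h₂) a := hP.1

theorem HasCoords.res_eta (hP : HasCoords P a b) : P.Res (eta l h₁ h₂) b := hP.2

theorem HasCoords.res_evalAt (hP : HasCoords P a b) (h : OnCurve l h₁ h₂ a b)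
    (g : CoordRing l h₁ h₂) :
    P.Res (algebraMap (CoordRing l h₁ h₂) (FunField l h₁ h₂) g) (evalAt h g) := by
  obtain ⟨p, rfl⟩ := AdjoinRoot.mk_surjective g
  rw [algebraMap_mk, evalAt_mk]
  induction p using Polynomial.induction_on' with
  | add p q hp hq => simpa using hp.add hq
  | monomial n c =>
    rw [eval₂_monomial, eval₂_monomial]
    have h1 : P.Res (aeval (lam l h₁ h₂) c) (aeval a c) := by
      simpa using hP.res_lam.aeval c
    have h2 : P.Res (eta l h₁ h₂ ^ n) (b ^ n) := by
      simpa using hP.res_eta.aeval (X ^ n)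
    exact h1.mul h2

/-- At a point where the projection to the `λ`-line is unramified, a regular function which
vanishes is divisible by `λ - a` in the local ring. -/
theorem exists_mul_eq_of_evalAt_eq_zero (h : OnCurve l h₁ h₂ a b) (hb : 3 * b ^ 2 - l ^ 2 ≠ 0)
    {g : CoordRing l h₁ h₂} (hg : evalAt h g = 0) :
    ∃ s g' : CoordRing l h₁ h₂, evalAt h s ≠ 0 ∧
      s * g = (lamA l h₁ h₂ - algebraMap ℂ _ a) * g' := by
  obtain ⟨p, rfl⟩ := AdjoinRoot.mk_surjective g
  obtain ⟨w, hw⟩ := X_sub_C_dvd_sub_C_eval (a := (C b : ℂ[X])) (p := p)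
  obtain ⟨u, hu⟩ := X_sub_C_dvd_sub_C_eval (a := a) (p := p.eval (C b))
  obtain ⟨r, hr⟩ := X_sub_C_dvd_sub_C_eval (a := a) (p := rhs h₁ h₂)
  have hlam : AdjoinRoot.of (curvePoly l h₁ h₂) (X - C a)
      = lamA l h₁ h₂ - algebraMap ℂ _ a := by
    rw [map_sub]; rfl
  have hev : (p.eval (C b)).eval a = 0 := by
    rw [evalAt_mk, show p = C (p.eval (C b)) + (X - C (C b)) * w by rw [← hw]; ring] at hg
    simpa [eval₂_add, eval₂_mul, eval₂_sub] using hg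
  rw [hev, C_0, sub_zero] at hu
  have hp : AdjoinRoot.mk (curvePoly l h₁ h₂) p = (lamA l h₁ h₂ - algebraMap ℂ _ a) *
      AdjoinRoot.of _ u + (etaA l h₁ h₂ - algebraMap ℂ _ b) * AdjoinRoot.mk _ w := by
    rw [show p = C (p.eval (C b)) + (X - C (C b)) * w by rw [← hw]; ring, map_add, map_mul,
      AdjoinRoot.mk_C, hu, map_mul, hlam]
    simp only [map_sub, AdjoinRoot.mk_X, AdjoinRoot.mk_C]
    rfl
  -- Subtracting the curve equation at `(a, b)` factors out `η - b`. The quadratic cofactor has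
  -- value `3b² - l² ≠ 0` at the point, so it can serve as `s`.
  have hcurve : (etaA l h₁ h₂ ^ 2 + algebraMap ℂ _ b * etaA l h₁ h₂ +
      algebraMap ℂ _ (b ^ 2 - l ^ 2)) * (etaA l h₁ h₂ - algebraMap ℂ _ b) =
      (lamA l h₁ h₂ - algebraMap ℂ _ a) * AdjoinRoot.of _ r := by
    rw [← hlam, ← map_mul, ← hr, map_sub (AdjoinRoot.of (curvePoly l h₁ h₂)), ← aeval_lamA (p := rhs h₁ h₂)]
    have h1 := etaA_eq l h₁ h₂
    have h2 : (rhs h₁ h₂).eval a = b ^ 3 - l ^ 2 * b := by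
      unfold OnCurve at h
      simp only [rhs, eval_add, eval_sub, eval_mul, eval_pow, eval_C, eval_X]
      linear_combination -h
    have h3 : AdjoinRoot.of (curvePoly l h₁ h₂) (C ((rhs h₁ h₂).eval a)) =
      algebraMap ℂ _ (b ^ 3 - l ^ 2 * b) := by rw [h2]; rfl
    rw [h3]
    simp only [map_sub, map_mul, map_pow] at h1 ⊢
    linear_combination h1
  refine ⟨etaA l h₁ h₂ ^ 2 + algebraMap ℂ _ b * etaA l h₁ h₂ + algebraMap ℂ _ (b ^ 2 - l ^ 2),
    (etaA l h₁ h₂ ^ 2 + algebraMap ℂ _ b * etaA l h₁ h₂ + algebraMap ℂ _ (b ^ 2 - l ^ 2)) *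
      AdjoinRoot.of _ u + AdjoinRoot.of _ r * AdjoinRoot.mk _ w, ?_, ?_⟩
  · have heta : evalAt h (etaA l h₁ h₂) = b := by simp [evalAt, etaA]
    simp only [map_add, map_mul, map_pow, heta, AlgHom.commutes, Algebra.algebraMap_self,
      RingHom.id_apply]
    intro h0
    apply hb
    linear_combination h0
  · rw [hp]
    linear_combination (AdjoinRoot.mk _ w) * hcurve

theorem lam_sub_ne_zero (a : ℂ) : lam l h₁ h₂ - algebraMap ℂ _ a ≠ 0 := by
  have h : lam l h₁ h₂ - algebraMap ℂ _ a =
      algebraMap (CoordRing l h₁ h₂) _ (AdjoinRoot.mk _ (C (X - C a))) := by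
    rw [algebraMap_mk]; simp
  rw [h, Ne, FaithfulSMul.algebraMap_eq_zero_iff, AdjoinRoot.mk_eq_zero]
  intro hd
  have := natDegree_le_of_dvd hd (C_ne_zero.2 (X_sub_C_ne_zero a))
  rw [natDegree_curvePoly, natDegree_C] at this
  omega

/-- Repeated division by `λ - a`. The place `P` bounds the number of divisions, since each one
raises the value of `g` by a factor of at least `exp 1`. -/
theorem HasCoords.exists_mul_eq_pow_mul (hP : HasCoords P a b) (h : OnCurve l h₁ h₂ a b)
    (hb : 3 * b ^ 2 - l ^ 2 ≠ 0) {g : CoordRing l h₁ h₂} (hg : g ≠ 0) :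
    ∃ (k : ℕ) (s t : CoordRing l h₁ h₂), evalAt h s ≠ 0 ∧ evalAt h t ≠ 0 ∧
      s * g = (lamA l h₁ h₂ - algebraMap ℂ _ a) ^ k * t := by
  have hlam : algebraMap _ (FunField l h₁ h₂) (lamA l h₁ h₂ - algebraMap ℂ _ a) =
      lam l h₁ h₂ - algebraMap ℂ _ a := by
    rw [map_sub, ← IsScalarTower.algebraMap_apply]; rfl
  have key : ∀ (n : ℕ) (g : CoordRing l h₁ h₂), g ≠ 0 →
      exp (-(n : ℤ)) ≤ P.v (algebraMap _ (FunField l h₁ h₂) g) →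
      ∃ (k : ℕ) (s t : CoordRing l h₁ h₂), evalAt h s ≠ 0 ∧ evalAt h t ≠ 0 ∧
      s * g = (lamA l h₁ h₂ - algebraMap ℂ _ a) ^ k * t := by
    intro n
    induction n with
    | zero =>
      intro g hg hn
      refine ⟨0, 1, g, by simp, fun h0 => ?_, by simp⟩
      have := hP.res_evalAt h g
      rw [h0, Place.res_zero_iff] at this
      simp only [Nat.cast_zero, neg_zero, exp_zero] at hn
      exact absurd hn (not_le.2 this)
    | succ n ih =>
      intro g hg hn
      by_cases hg0 : evalAt h g = 0
      · obtain ⟨s, g', hs, hsg⟩ := exists_mul_eq_of_evalAt_eq_zero h hb hg0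
        have hs0 : s ≠ 0 := by rintro rfl; simp at hs
        have hg' : g' ≠ 0 := by
          rintro rfl
          rw [mul_zero] at hsg
          exact mul_ne_zero hs0 hg hsg
        obtain ⟨k, s', t, hs', ht, hst⟩ := ih g' hg' (by
          have h1 := congrArg (fun z => P.v (algebraMap _ (FunField l h₁ h₂) z)) hsg
          simp only [map_mul, hlam, (hP.res_evalAt h s).v_eq_one hs, one_mul] at h1
          rw [h1] at hn
          have h2 := hn.trans (mul_le_mul_left (le_exp_neg_one hP.1) _)
          rw [Nat.cast_succ, neg_add, add_comm, exp_add] at h2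
          exact le_of_mul_le_mul_left h2 exp_pos)
        refine ⟨k + 1, s' * s, t, by simp [hs, hs'], ht, ?_⟩
        rw [mul_assoc, hsg, pow_succ]
        linear_combination (lamA l h₁ h₂ - algebraMap ℂ _ a) * hst
      · exact ⟨0, 1, g, by simp, hg0, by simp⟩
  have hv : P.v (algebraMap _ (FunField l h₁ h₂) g) ≠ 0 := by simpa using hg
  obtain ⟨n, hn⟩ := exists_exp_neg_natCast_lt hv
  exact key n g hg hn.le

/-- The exponent and the unit do not depend on the place `P'` with these coordinates; this is what
makes the point unique. -/
theorem HasCoords.exists_eq_zpow_mul (hP : HasCoords P a b) (h : OnCurve l h₁ h₂ a b)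
    (hb : 3 * b ^ 2 - l ^ 2 ≠ 0) {f : FunField l h₁ h₂} (hf : f ≠ 0) :
    ∃ (k : ℤ) (f' : FunField l h₁ h₂) (c : ℂ), c ≠ 0 ∧
      (∀ P' : Place (FunField l h₁ h₂), HasCoords P' a b → P'.Res f' c) ∧
      f = (lam l h₁ h₂ - algebraMap ℂ _ a) ^ k * f' := by
  have hlam : algebraMap _ (FunField l h₁ h₂) (lamA l h₁ h₂ - algebraMap ℂ _ a) =
      lam l h₁ h₂ - algebraMap ℂ _ a := by
    rw [map_sub, ← IsScalarTower.algebraMap_apply]; rfl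
  have hl0 := lam_sub_ne_zero (l := l) (h₁ := h₁) (h₂ := h₂) a
  have key : ∀ g : CoordRing l h₁ h₂, g ≠ 0 → ∃ (k : ℤ) (f' : FunField l h₁ h₂) (c : ℂ), c ≠ 0 ∧
      (∀ P' : Place (FunField l h₁ h₂), HasCoords P' a b → P'.Res f' c) ∧
      algebraMap _ (FunField l h₁ h₂) g = (lam l h₁ h₂ - algebraMap ℂ _ a) ^ k * f' := by
    intro g hg
    obtain ⟨k, s, t, hs, ht, hst⟩ := hP.exists_mul_eq_pow_mul h hb hg
    refine ⟨k, algebraMap _ _ t * (algebraMap _ _ s)⁻¹, evalAt h t * (evalAt h s)⁻¹,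
      mul_ne_zero ht (inv_ne_zero hs),
      fun P' hP' => (hP'.res_evalAt h t).mul ((hP'.res_evalAt h s).inv hs), ?_⟩
    have hs0 : algebraMap _ (FunField l h₁ h₂) s ≠ 0 := by
      rw [Ne, FaithfulSMul.algebraMap_eq_zero_iff]; rintro rfl; simp at hs
    have := congrArg (algebraMap _ (FunField l h₁ h₂)) hst
    rw [map_mul, map_mul, map_pow, hlam] at this
    rw [zpow_natCast]
    field_simp
    linear_combination this
  obtain ⟨g, d, hd, rfl⟩ := IsFractionRing.div_surjective (A := CoordRing l h₁ h₂) f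
  have hd0 : d ≠ 0 := nonZeroDivisors.ne_zero hd
  have hg0 : g ≠ 0 := by rintro rfl; simp at hf
  obtain ⟨k, f', c, hc, hf', hg⟩ := key g hg0
  obtain ⟨m, d', e, he, hd', hde⟩ := key d hd0
  refine ⟨k - m, f' * d'⁻¹, c * e⁻¹, mul_ne_zero hc (inv_ne_zero he),
    fun P' hP' => (hf' P' hP').mul ((hd' P' hP').inv he), ?_⟩
  rw [hg, hde, zpow_sub₀ hl0]
  simp only [div_eq_mul_inv, mul_inv]
  ring

/-- All values of nonzero functions are powers of that of `λ - a`. As the valuation is onto, this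
value generates the value group, and it is less than one. -/
theorem HasCoords.v_lam_sub (hP : HasCoords P a b) (h : OnCurve l h₁ h₂ a b)
    (hb : 3 * b ^ 2 - l ^ 2 ≠ 0) : P.v (lam l h₁ h₂ - algebraMap ℂ _ a) = exp (-1) := by
  obtain ⟨f, hf⟩ := P.surjective (exp (-1))
  have hf0 : f ≠ 0 := by
    rintro rfl
    exact exp_ne_zero (hf.symm.trans (map_zero _))
  obtain ⟨k, f', c, hc, hf', rfl⟩ := hP.exists_eq_zpow_mul h hb hf0
  rw [map_mul, map_zpow₀, (hf' P hP).v_eq_one hc, mul_one] at hf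
  have hv : P.v (lam l h₁ h₂ - algebraMap ℂ _ a) ≠ 0 := by
    simpa using lam_sub_ne_zero (l := l) (h₁ := h₁) (h₂ := h₂) a
  have hlt : log (P.v (lam l h₁ h₂ - algebraMap ℂ _ a)) < 0 := by
    rw [log_lt_iff_lt_exp hv]; exact hP.1
  rw [← exp_log hv] at hf ⊢
  rw [← exp_zsmul, exp_inj, smul_eq_mul] at hf
  rw [exp_inj]
  rcases Int.eq_one_or_neg_one_of_mul_eq_neg_one' hf with h1 | h1
  · exact h1.2
  · omega

theorem HasCoords.unique (hP : HasCoords P a b) (hP' : HasCoords P' a b)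
    (h : OnCurve l h₁ h₂ a b) (hb : 3 * b ^ 2 - l ^ 2 ≠ 0) : P = P' := by
  ext f
  rcases eq_or_ne f 0 with rfl | hf
  · simp
  obtain ⟨k, f', c, hc, hf', rfl⟩ := hP.exists_eq_zpow_mul h hb hf
  rw [map_mul, map_mul, map_zpow₀, map_zpow₀, (hf' P hP).v_eq_one hc, (hf' P' hP').v_eq_one hc,
    hP.v_lam_sub h hb, hP'.v_lam_sub h hb]

theorem HasCoords.exists_res (hP : HasCoords P a b) (h : OnCurve l h₁ h₂ a b)
    (hb : 3 * b ^ 2 - l ^ 2 ≠ 0) {f : FunField l h₁ h₂} (hf : P.v f ≤ 1) : ∃ c, P.Res f c := by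
  rcases eq_or_ne f 0 with rfl | hf0
  · exact ⟨0, by simpa using P.res_const 0⟩
  rcases hf.lt_or_eq with hlt | heq
  · exact ⟨0, Place.res_zero_iff.2 hlt⟩
  obtain ⟨k, f', c, hc, hf', rfl⟩ := hP.exists_eq_zpow_mul h hb hf0
  rw [map_mul, map_zpow₀, (hf' P hP).v_eq_one hc, mul_one, hP.v_lam_sub h hb, ← exp_zsmul,
    exp_eq_one] at heq
  have hk : k = 0 := by simpa using heq
  subst hk
  exact ⟨c, by simpa using hf' P hP⟩

/-- Integrality of `η` over `ℂ[λ]`: at a pole of `η` the term `η³` would dominate the equation. -/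
theorem v_eta_le_one (h : P.v (lam l h₁ h₂) ≤ 1) : P.v (eta l h₁ h₂) ≤ 1 := by
  by_contra! hlt
  have h1 := P.v_aeval_le_one h (rhs h₁ h₂)
  have h2 : P.v (algebraMap ℂ _ (l ^ 2) * eta l h₁ h₂) < P.v (eta l h₁ h₂ ^ 3) := by
    rw [map_mul, map_pow P.v]
    refine (mul_le_of_le_one_left' (P.v_const_le _)).trans_lt ?_
    exact lt_self_pow₀ hlt (by norm_num)
  rw [← eta_eq, P.v.map_sub_eq_of_lt_left h2, map_pow] at h1
  exact absurd h1 (not_le.2 (one_lt_pow₀ hlt (by norm_num)))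

end Points

/-! ### The point at infinity -/

section Infinity

theorem Place.v_aeval_of_one_lt {F : Type*} [Field F] [Algebra ℂ F] {P : Place F} {f : F}
    (h : 1 < P.v f) {p : ℂ[X]} (hp : p ≠ 0) : P.v (aeval f p) = P.v f ^ p.natDegree := by
  have hlead : P.v (p.coeff p.natDegree • f ^ p.natDegree) = P.v f ^ p.natDegree := by
    rw [Algebra.smul_def, map_mul, map_pow, P.trivial_on_const _ (by simpa using hp), one_mul]
  rw [aeval_eq_sum_range, Finset.sum_range_succ, P.v.map_add_eq_of_lt_right, hlead]
  rw [hlead]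
  refine P.v.map_sum_lt (pow_ne_zero _ (zero_lt_one.trans h).ne') fun i hi => ?_
  rw [Algebra.smul_def, map_mul, map_pow]
  exact (mul_le_of_le_one_left' (P.v_const_le _)).trans_lt
    (pow_lt_pow_right₀ h (Finset.mem_range.1 hi))

variable {l h₁ h₂ : ℂ} {P P' : Place (FunField l h₁ h₂)}

/-- Comparing the dominant terms `η³` and `729 λ⁵` gives `3 log v(η) = 5 log v(λ)`, and 3 and 5 are
coprime. -/
theorem IsInfinity.exists_exp (h : IsInfinity P) :
    ∃ k : ℤ, 0 < k ∧ P.v (lam l h₁ h₂) = exp (k * 3) ∧ P.v (eta l h₁ h₂) = exp (k * 5) := by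
  have hl0 : P.v (lam l h₁ h₂) ≠ 0 := (zero_lt_one.trans h).ne'
  have hr0 : rhs h₁ h₂ ≠ 0 := by
    intro h0
    simpa [h0] using natDegree_rhs h₁ h₂
  have hr := Place.v_aeval_of_one_lt h hr0
  rw [natDegree_rhs, ← eta_eq] at hr
  have he : 1 < P.v (eta l h₁ h₂) := by
    by_contra! hle
    have : P.v (eta l h₁ h₂ ^ 3 - algebraMap ℂ _ (l ^ 2) * eta l h₁ h₂) ≤ 1 := by
      refine P.v.map_sub_le ?_ ?_
      · rw [map_pow]; exact pow_le_one' hle _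
      · rw [map_mul]; exact mul_le_one' (P.v_const_le _) hle
    rw [hr] at this
    exact absurd this (not_le.2 (one_lt_pow₀ h (by norm_num)))
  have h2 : P.v (algebraMap ℂ _ (l ^ 2) * eta l h₁ h₂) < P.v (eta l h₁ h₂ ^ 3) := by
    rw [map_mul, map_pow P.v]
    refine (mul_le_of_le_one_left' (P.v_const_le _)).trans_lt ?_
    exact lt_self_pow₀ he (by norm_num)
  rw [P.v.map_sub_eq_of_lt_left h2, map_pow] at hr
  have he0 : P.v (eta l h₁ h₂) ≠ 0 := (zero_lt_one.trans he).ne'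
  have hlog := congrArg log hr
  rw [log_pow, log_pow] at hlog
  have hpos : 0 < log (P.v (lam l h₁ h₂)) := by
    rw [lt_log_iff_exp_lt hl0]; exact h
  simp only [nsmul_eq_mul, Nat.cast_ofNat] at hlog
  -- Bézout: `2 · 3 - 5 = 1`.
  refine ⟨2 * log (P.v (lam l h₁ h₂)) - log (P.v (eta l h₁ h₂)), by omega, ?_, ?_⟩
  · rw [← exp_log hl0, exp_inj, exp_log hl0]; omega
  · rw [← exp_log he0, exp_inj, exp_log he0]; omega

/-- The function `f` has a pole of order `n` at every point at infinity, up to the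
normalization of its valuation. -/
def HasPoleOrder (f : FunField l h₁ h₂) (n : ℤ) : Prop :=
  ∀ (P : Place (FunField l h₁ h₂)) (k : ℤ), 0 < k → P.v (lam l h₁ h₂) = exp (k * 3) →
    P.v (eta l h₁ h₂) = exp (k * 5) → P.v f = exp (k * n)

theorem HasPoleOrder.add {f g : FunField l h₁ h₂} {m n : ℤ} (hf : HasPoleOrder f m)
    (hg : HasPoleOrder g n) (hmn : m ≠ n) : HasPoleOrder (f + g) (max m n) := by
  intro P k hk h3 h5
  have hne : P.v f ≠ P.v g := by
    rw [hf P k hk h3 h5, hg P k hk h3 h5, Ne, exp_inj]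
    exact fun h => hmn (mul_left_cancel₀ hk.ne' h)
  rw [P.v.map_add_of_distinct_val hne, hf P k hk h3 h5, hg P k hk h3 h5]
  rcases le_total m n with h | h
  · rw [max_eq_right h, max_eq_right]
    exact exp_le_exp.2 (mul_le_mul_of_nonneg_left h hk.le)
  · rw [max_eq_left h, max_eq_left]
    exact exp_le_exp.2 (mul_le_mul_of_nonneg_left h hk.le)

theorem aeval_mul_eta_pow_hasPoleOrder (p : ℂ[X]) (i : ℕ) :
    p = 0 ∨ HasPoleOrder (aeval (lam l h₁ h₂) p * eta l h₁ h₂ ^ i)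
      (3 * (p.natDegree : ℤ) + 5 * i) := by
  refine or_iff_not_imp_left.2 fun hp P k hk h3 h5 => ?_
  have h1 : 1 < P.v (lam l h₁ h₂) := by
    rw [h3, ← exp_zero, exp_lt_exp]; positivity
  rw [map_mul, map_pow, Place.v_aeval_of_one_lt h1 hp, h3, h5, ← exp_nsmul, ← exp_nsmul,
    ← exp_add]
  congr 1
  simp only [nsmul_eq_mul]
  ring

/-- In the basis `1, η, η²` over `ℂ[λ]` the nonzero terms have pole orders congruent to `0, 2, 1`
modulo 3, so no cancellation can occur and the largest order wins. -/
theorem exists_hasPoleOrder_algebraMap {g : CoordRing l h₁ h₂} (hg : g ≠ 0) :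
    ∃ n, HasPoleOrder (algebraMap _ (FunField l h₁ h₂) g) n := by
  obtain ⟨p, rfl⟩ := AdjoinRoot.mk_surjective g
  set q := p %ₘ curvePoly l h₁ h₂ with hq
  have hpq : AdjoinRoot.mk (curvePoly l h₁ h₂) p = AdjoinRoot.mk _ q := by
    rw [AdjoinRoot.mk_eq_mk]
    exact ⟨p /ₘ curvePoly l h₁ h₂, by rw [hq, sub_eq_iff_eq_add', modByMonic_add_div]⟩
  rw [hpq] at hg ⊢
  have hdeg : q.natDegree < 3 := by
    rw [← natDegree_curvePoly l h₁ h₂]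
    refine natDegree_modByMonic_lt _ (monic_curvePoly l h₁ h₂) fun h => ?_
    simpa [h] using natDegree_curvePoly l h₁ h₂
  have hsum : algebraMap _ (FunField l h₁ h₂) (AdjoinRoot.mk (curvePoly l h₁ h₂) q) =
      aeval (lam l h₁ h₂) (q.coeff 0) * eta l h₁ h₂ ^ 0 +
      aeval (lam l h₁ h₂) (q.coeff 1) * eta l h₁ h₂ ^ 1 +
      aeval (lam l h₁ h₂) (q.coeff 2) * eta l h₁ h₂ ^ 2 := by
    rw [algebraMap_mk, eval₂_eq_sum_range' _ hdeg, Finset.sum_range_succ, Finset.sum_range_succ,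
      Finset.sum_range_one]
    rfl
  have hmod : ∀ {f g : FunField l h₁ h₂} {r s : ℤ},
      (f = 0 ∨ ∃ n, HasPoleOrder f n ∧ n % 3 = r) → (g = 0 ∨ ∃ n, HasPoleOrder g n ∧ n % 3 = s) →
      r ≠ s → f + g = 0 ∨ ∃ n, HasPoleOrder (f + g) n ∧ (n % 3 = r ∨ n % 3 = s) := by
    rintro f g r s (rfl | ⟨m, hm, hmr⟩) (rfl | ⟨n, hn, hns⟩) hrs
    · simp
    · exact Or.inr ⟨n, by simpa using hn, Or.inr hns⟩
    · exact Or.inr ⟨m, by simpa using hm, Or.inl hmr⟩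
    · refine Or.inr ⟨_, hm.add hn (by rintro rfl; exact hrs (hmr.symm.trans hns)), ?_⟩
      rcases max_choice m n with h | h <;> simp [h, hmr, hns]
  have hterm : ∀ i : ℕ, aeval (lam l h₁ h₂) (q.coeff i) * eta l h₁ h₂ ^ i = 0 ∨
      ∃ n, HasPoleOrder (aeval (lam l h₁ h₂) (q.coeff i) * eta l h₁ h₂ ^ i) n ∧
        n % 3 = (5 * i : ℤ) % 3 := by
    intro i
    rcases aeval_mul_eta_pow_hasPoleOrder (l := l) (h₁ := h₁) (h₂ := h₂) (q.coeff i) i with h | h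
    · left; simp [h]
    · exact Or.inr ⟨_, h, by omega⟩
  have hg' : algebraMap _ (FunField l h₁ h₂) (AdjoinRoot.mk (curvePoly l h₁ h₂) q) ≠ 0 := by
    rwa [Ne, FaithfulSMul.algebraMap_eq_zero_iff]
  rw [hsum] at hg' ⊢
  rcases hmod (hterm 0) (hterm 1) (by norm_num) with h01 | ⟨n, hn, hr⟩
  · rw [h01, zero_add] at hg' ⊢
    exact ((hterm 2).resolve_left hg').imp fun _ h => h.1
  · rcases hterm 2 with h2 | ⟨m, hm, hms⟩
    · exact ⟨n, by simpa [h2] using hn⟩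
    · exact ⟨_, hn.add hm (by rintro rfl; norm_num at hr hms; omega)⟩

theorem exists_hasPoleOrder {f : FunField l h₁ h₂} (hf : f ≠ 0) : ∃ n, HasPoleOrder f n := by
  obtain ⟨g, d, hd, rfl⟩ := IsFractionRing.div_surjective (A := CoordRing l h₁ h₂) f
  have hd0 : d ≠ 0 := nonZeroDivisors.ne_zero hd
  have hg0 : g ≠ 0 := by rintro rfl; simp at hf
  obtain ⟨m, hm⟩ := exists_hasPoleOrder_algebraMap hg0
  obtain ⟨n, hn⟩ := exists_hasPoleOrder_algebraMap hd0
  refine ⟨m - n, fun P k hk h3 h5 => ?_⟩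
  rw [map_div₀, hm P k hk h3 h5, hn P k hk h3 h5, ← exp_sub, mul_sub]

/-- Every value is a power of `exp k`, so surjectivity of the valuation forces `k = 1`. -/
theorem IsInfinity.v_eq_exp (h : IsInfinity P) :
    P.v (lam l h₁ h₂) = exp 3 ∧ P.v (eta l h₁ h₂) = exp 5 := by
  obtain ⟨k, hk, h3, h5⟩ := h.exists_exp
  obtain ⟨f, hf⟩ := P.surjective (exp 1)
  have hf0 : f ≠ 0 := by
    rintro rfl
    exact exp_ne_zero (hf.symm.trans (map_zero _))
  obtain ⟨n, hn⟩ := exists_hasPoleOrder hf0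
  rw [hn P k hk h3 h5, exp_inj] at hf
  have hk1 : k = 1 := by
    rcases Int.eq_one_or_neg_one_of_mul_eq_one hf with h | h <;> omega
  subst hk1
  exact ⟨h3, h5⟩

theorem IsInfinity.unique (h : IsInfinity P) (h' : IsInfinity P') : P = P' := by
  ext f
  rcases eq_or_ne f 0 with rfl | hf
  · simp
  obtain ⟨n, hn⟩ := exists_hasPoleOrder hf
  rw [hn P 1 one_pos h.v_eq_exp.1 h.v_eq_exp.2, hn P' 1 one_pos h'.v_eq_exp.1 h'.v_eq_exp.2]

/-- A function of degree one in `η` does not vanish. -/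
theorem aeval_add_aeval_mul_eta_ne_zero {infty : Place (FunField l h₁ h₂)}
    (h : IsInfinity infty) (p : ℂ[X]) {q : ℂ[X]} (hq : q ≠ 0) :
    aeval (lam l h₁ h₂) p + aeval (lam l h₁ h₂) q * eta l h₁ h₂ ≠ 0 := by
  -- The orders `3 deg p` and `3 deg q + 5` differ modulo 3, so the two terms cannot cancel.
  have key : ∃ n, HasPoleOrder
      (aeval (lam l h₁ h₂) p + aeval (lam l h₁ h₂) q * eta l h₁ h₂) n := by
    have h1 := (aeval_mul_eta_pow_hasPoleOrder (l := l) (h₁ := h₁) (h₂ := h₂) q 1).resolve_left hq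
    rw [pow_one] at h1
    rcases aeval_mul_eta_pow_hasPoleOrder (l := l) (h₁ := h₁) (h₂ := h₂) p 0 with rfl | h0
    · exact ⟨_, by simpa using h1⟩
    · rw [pow_zero, mul_one] at h0
      exact ⟨_, h0.add h1 (by push_cast; omega)⟩
  obtain ⟨n, hn⟩ := key
  intro h0
  have := hn infty 1 one_pos h.v_eq_exp.1 h.v_eq_exp.2
  rw [h0, map_zero] at this
  exact exp_ne_zero this.symm

end Infinity

/-! ### The Lax matrix and the intertwining matrix over the function field -/

section Intertwiner

variable {R : Type*} [CommRing R] [Algebra ℂ R]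

theorem laxL_map {S : Type*} [CommRing S] [Algebra ℂ S] (l : ℂ) (x : Phase) (t : R)
    (f : R →ₐ[ℂ] S) : laxL l x (f t) = (laxL l x t).map f := by
  ext i j
  fin_cases i <;> fin_cases j <;> simp [laxL, map_ofNat f]

theorem laxL_mulVec_eq_smul_iff (l : ℂ) (x : Phase) (t b : R) (u : Fin 3 → R) :
    (laxL l x t).mulVec u = b • u ↔
      (6 * t * algebraMap ℂ R x.q₁ * u 0 - algebraMap ℂ R ((3 * x.q₁ ^ 2 + x.q₂ ^ 2) / 2) * u 1
        + (9 * t - 3 * algebraMap ℂ R x.p₁) * u 2 = b * u 0) ∧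
      ((9 * t ^ 2 + 3 * t * algebraMap ℂ R x.p₁) * u 0
        + (-3 * t * algebraMap ℂ R x.q₁ - algebraMap ℂ R (x.q₂ * x.p₂)) * u 1
        + algebraMap ℂ R (x.q₂ ^ 2) * u 2 = b * u 1) ∧
      (-t * algebraMap ℂ R ((3 * x.q₁ ^ 2 + x.q₂ ^ 2) / 2) * u 0
        + (9 * t ^ 2 + algebraMap ℂ R (l ^ 2 / x.q₂ ^ 2 - x.p₂ ^ 2)) * u 1
        + (algebraMap ℂ R (x.q₂ * x.p₂) - 3 * t * algebraMap ℂ R x.q₁) * u 2 = b * u 2) := by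
  simp only [funext_iff, Fin.forall_fin_succ, laxL, Matrix.mulVec, dotProduct,
    Fin.sum_univ_three, Pi.smul_apply, smul_eq_mul]
  simp [sub_eq_add_neg]

/-- The intertwining matrix, for a spectral parameter `t` in any `ℂ`-algebra. -/
def intertwiner (μ Y₁ Y₂ : ℂ) (t : R) : Matrix (Fin 3) (Fin 3) R :=
  let c : ℂ → R := algebraMap ℂ R
  !![c μ - t, c (-2 * Y₂), c (2 * Y₁);
     c (2 * Y₁) * t, c (2 * Y₁ * Y₂ - μ) - t, c (-2 * Y₁ ^ 2);
     c (2 * (Y₂ - 2 * Y₁ ^ 2)) * t, c (2 * Y₂ * (Y₂ - 2 * Y₁ ^ 2) + 2 * Y₁ * μ) + c (2 * Y₁) * t,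
       c (-2 * Y₁ * (Y₂ - 2 * Y₁ ^ 2) - μ) - t]

/-- The matrix inverse to the intertwining matrix up to the scalar factor `μ² - t²`. -/
def cointertwiner (μ Y₁ Y₂ : ℂ) (t : R) : Matrix (Fin 3) (Fin 3) R :=
  let c : ℂ → R := algebraMap ℂ R
  !![c μ + t, c (-2 * (Y₂ - 2 * Y₁ ^ 2)), c (2 * Y₁);
     c (2 * Y₁) * t, c (-2 * Y₁ * (Y₂ - 2 * Y₁ ^ 2) - μ) + t, c (2 * Y₁ ^ 2);
     c (2 * Y₂) * t, c (-2 * Y₂ * (Y₂ - 2 * Y₁ ^ 2) - 2 * Y₁ * μ) + c (2 * Y₁) * t,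
       c (2 * Y₁ * Y₂ - μ) + t]

theorem matM_eq_intertwiner (μ Y₁ Y₂ t : ℂ) : matM μ Y₁ Y₂ t = intertwiner μ Y₁ Y₂ t := by
  ext i j
  fin_cases i <;> fin_cases j <;> simp [matM, intertwiner] <;> ring

theorem intertwiner_map {S : Type*} [CommRing S] [Algebra ℂ S] (μ Y₁ Y₂ : ℂ) (t : R)
    (f : R →ₐ[ℂ] S) : intertwiner μ Y₁ Y₂ (f t) = (intertwiner μ Y₁ Y₂ t).map f := by
  ext i j
  fin_cases i <;> fin_cases j <;> simp [intertwiner]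

theorem cointertwiner_mul_intertwiner (μ Y₁ Y₂ : ℂ) (t : R) :
    cointertwiner μ Y₁ Y₂ t * intertwiner μ Y₁ Y₂ t =
      (algebraMap ℂ R μ ^ 2 - t ^ 2) • (1 : Matrix (Fin 3) (Fin 3) R) := by
  ext i j
  fin_cases i <;> fin_cases j <;>
    simp [intertwiner, cointertwiner, Matrix.mul_apply, Fin.sum_univ_three,
      map_ofNat (algebraMap ℂ R)] <;> ring

/-- The entries are polynomials in the spectral parameter that agree on the infinite field `ℂ`. The
identity therefore holds in `ℂ[X]` and specializes to any algebra, in particular at `λ` in the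
function field. -/
theorem laxL_mul_intertwiner_of_forall {l μ Y₁ Y₂ : ℂ} {x x' : Phase}
    (h : ∀ t : ℂ, laxL l x' t * matM μ Y₁ Y₂ t = matM μ Y₁ Y₂ t * laxL l x t) (t : R) :
    laxL l x' t * intertwiner μ Y₁ Y₂ t = intertwiner μ Y₁ Y₂ t * laxL l x t := by
  have hX : laxL l x' (X : ℂ[X]) * intertwiner μ Y₁ Y₂ X =
      intertwiner μ Y₁ Y₂ X * laxL l x X := by
    ext1 i j
    refine Polynomial.funext fun s => ?_
    have hs := congrFun (congrFun (h s) i) j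
    rw [matM_eq_intertwiner, show s = aeval s (X : ℂ[X]) by simp, laxL_map, laxL_map,
      intertwiner_map, ← Matrix.map_mul, ← Matrix.map_mul] at hs
    simpa using hs
  rw [show t = aeval t (X : ℂ[X]) by simp, laxL_map, laxL_map, intertwiner_map,
    ← Matrix.map_mul, ← Matrix.map_mul, hX]

/-- Rows two and three are multiples of row one modulo `t + μ`. This shows both the rank one at `t =
-μ` and, for `μ ≠ 0`, the kernel at `t = μ`. -/
theorem intertwiner_mulVec_apply (μ Y₁ Y₂ : ℂ) (t : R) (u : Fin 3 → R) :
    (intertwiner μ Y₁ Y₂ t).mulVec u 0 = (algebraMap ℂ R μ - t) * u 0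
      + algebraMap ℂ R (-2 * Y₂) * u 1 + algebraMap ℂ R (2 * Y₁) * u 2 ∧
    (intertwiner μ Y₁ Y₂ t).mulVec u 1 = (t + algebraMap ℂ R μ) * (algebraMap ℂ R Y₁ * u 0 - u 1)
      - algebraMap ℂ R Y₁ * (intertwiner μ Y₁ Y₂ t).mulVec u 0 ∧
    (intertwiner μ Y₁ Y₂ t).mulVec u 2 = (t + algebraMap ℂ R μ) *
        (algebraMap ℂ R (Y₂ - 2 * Y₁ ^ 2) * u 0 + algebraMap ℂ R (2 * Y₁) * u 1 - u 2)
      - algebraMap ℂ R (Y₂ - 2 * Y₁ ^ 2) * (intertwiner μ Y₁ Y₂ t).mulVec u 0 := by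
  refine ⟨?_, ?_, ?_⟩ <;>
    simp [intertwiner, Matrix.mulVec, dotProduct, Fin.sum_univ_three,
      map_ofNat (algebraMap ℂ R)] <;> ring

end Intertwiner

/-! ### Eigenvectors -/

section Eigenvectors

/-- Eigenvectors for three distinct eigenvalues span. -/
theorem exists_eq_sum_eigenvectors {A : Matrix (Fin 3) (Fin 3) ℂ} {e : Fin 3 → ℂ}
    (he : Function.Injective e) {u : Fin 3 → Fin 3 → ℂ} (hu : ∀ i, u i ≠ 0)
    (hA : ∀ i, A.mulVec (u i) = e i • u i) :
    LinearIndependent ℂ u ∧ ∀ w : Fin 3 → ℂ, ∃ c : Fin 3 → ℂ, ∑ i, c i • u i = w := by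
  have hli : LinearIndependent ℂ u :=
    Module.End.eigenvectors_linearIndependent' (Matrix.mulVecLin A) e he u fun i =>
      ⟨Module.End.mem_eigenspace_iff.2 (by simpa using hA i), hu i⟩
  refine ⟨hli, fun w => ?_⟩
  have hspan := hli.span_eq_top_of_card_eq_finrank' (by simp)
  exact (Submodule.mem_span_range_iff_exists_fun ℂ).1 (hspan ▸ Submodule.mem_top)

theorem exists_eq_smul_eigenvector {A : Matrix (Fin 3) (Fin 3) ℂ} {e : Fin 3 → ℂ}
    (he : Function.Injective e) {u : Fin 3 → Fin 3 → ℂ} (hu : ∀ i, u i ≠ 0)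
    (hA : ∀ i, A.mulVec (u i) = e i • u i) {i : Fin 3} {w : Fin 3 → ℂ}
    (hw : A.mulVec w = e i • w) : ∃ k : ℂ, w = k • u i := by
  obtain ⟨hli, hspan⟩ := exists_eq_sum_eigenvectors he hu hA
  obtain ⟨c, rfl⟩ := hspan w
  -- Applying `A - e i` to the expansion of `w` leaves only the other eigenvectors.
  have h0 : ∑ j, (c j * (e j - e i)) • u j = 0 := by
    rw [Matrix.mulVec_sum, Finset.smul_sum, ← sub_eq_zero, ← Finset.sum_sub_distrib] at hw
    rw [← hw]
    refine Finset.sum_congr rfl fun j _ => ?_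
    rw [Matrix.mulVec_smul, hA]
    module
  have hc := Fintype.linearIndependent_iff.1 hli _ h0
  refine ⟨c i, Finset.sum_eq_single i (fun j _ hji => ?_) (by simp)⟩
  have := (mul_eq_zero.1 (hc j)).resolve_right (sub_ne_zero.2 (he.ne hji))
  rw [this, zero_smul]

variable {l h₁ h₂ : ℂ} {P : Place (FunField l h₁ h₂)} {x : Phase}
  {ψ : Fin 3 → FunField l h₁ h₂}

/-- With `ψ 0 = 0` the first two rows are a linear system for `ψ 1, ψ 2`. Its determinant has degree
one in `η` with leading coefficient `9λ - 3p₁ ≠ 0`, so it does not vanish on the curve. -/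
theorem eq_zero_of_apply_zero_eq_zero {infty : Place (FunField l h₁ h₂)}
    (h_infty : IsInfinity infty) (h : (laxL l x (lam l h₁ h₂)).mulVec ψ = eta l h₁ h₂ • ψ)
    (h0 : ψ 0 = 0) : ψ = 0 := by
  obtain ⟨e0, e1, -⟩ := (laxL_mulVec_eq_smul_iff l x _ _ ψ).1 h
  have hq2 : algebraMap ℂ (FunField l h₁ h₂) (x.q₂ ^ 2) ≠ 0 := by
    simpa using x.q₂_ne_zero
  have hB : (C 9 * X - C (3 * x.p₁) : ℂ[X]) ≠ 0 := by
    intro hB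
    have := congrArg (fun p => coeff p 1) hB
    simp [coeff_C] at this
  have hminor := aeval_add_aeval_mul_eta_ne_zero h_infty
    (-C ((3 * x.q₁ ^ 2 + x.q₂ ^ 2) / 2 * x.q₂ ^ 2)
      - (C 9 * X - C (3 * x.p₁)) * (-(C (3 * x.q₁) * X) - C (x.q₂ * x.p₂))) hB
  simp only [map_sub, map_neg, map_mul, aeval_C, aeval_X, map_ofNat] at hminor
  rw [h0] at e0 e1
  simp only [map_mul] at e0 e1
  have h1 : ψ 1 = 0 := by
    refine (mul_eq_zero.1 ?_).resolve_left hminor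
    linear_combination (algebraMap ℂ (FunField l h₁ h₂) (x.q₂ ^ 2)) * e0
      - (9 * lam l h₁ h₂ - 3 * algebraMap ℂ _ x.p₁) * e1
  have h2 : ψ 2 = 0 := by
    rw [h1] at e1
    refine (mul_eq_zero.1 ?_).resolve_left hq2
    linear_combination e1
  funext i
  fin_cases i <;> simp [h0, h1, h2]

/-- The eigenvectors of the Lax matrix over the function field are unique up to a factor. -/
theorem exists_eq_smul_of_eigenvectors {infty : Place (FunField l h₁ h₂)}
    (h_infty : IsInfinity infty) {ψ' : Fin 3 → FunField l h₁ h₂} (hψ0 : ψ ≠ 0) (hψ'0 : ψ' ≠ 0)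
    (hψ : (laxL l x (lam l h₁ h₂)).mulVec ψ = eta l h₁ h₂ • ψ)
    (hψ' : (laxL l x (lam l h₁ h₂)).mulVec ψ' = eta l h₁ h₂ • ψ') :
    ∃ f : FunField l h₁ h₂, f ≠ 0 ∧ ψ' = f • ψ := by
  have h0 : ψ 0 ≠ 0 := fun h => hψ0 (eq_zero_of_apply_zero_eq_zero h_infty hψ h)
  have h0' : ψ' 0 ≠ 0 := fun h => hψ'0 (eq_zero_of_apply_zero_eq_zero h_infty hψ' h)
  refine ⟨ψ' 0 / ψ 0, div_ne_zero h0' h0, sub_eq_zero.1 ?_⟩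
  refine eq_zero_of_apply_zero_eq_zero h_infty (x := x) ?_ (by simp [h0])
  rw [Matrix.mulVec_sub, Matrix.mulVec_smul, hψ, hψ', smul_sub, smul_comm]

/-- Reduction of the eigenvector equation at `P`; the normalization keeps the residue vector from
vanishing. -/
theorem exists_res_eigenvector {a b : ℂ} (hP : HasCoords P a b) (h : OnCurve l h₁ h₂ a b)
    (hb : 3 * b ^ 2 - l ^ 2 ≠ 0) (hψ1 : vmax P.v ψ = 1)
    (hψ : (laxL l x (lam l h₁ h₂)).mulVec ψ = eta l h₁ h₂ • ψ) :
    ∃ u : Fin 3 → ℂ, u ≠ 0 ∧ (∀ i, P.Res (ψ i) (u i)) ∧ (laxL l x a).mulVec u = b • u := by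
  choose u hu using fun i => hP.exists_res h hb (hψ1 ▸ le_vmax (v := P.v) ψ i)
  refine ⟨u, ?_, hu, ?_⟩
  · rintro rfl
    obtain ⟨i, hi⟩ := exists_eq_vmax P.v ψ
    have := Place.res_zero_iff.1 (hu i)
    rw [hi, hψ1] at this
    exact lt_irrefl _ this
  · funext i
    have hL : ∀ i j, P.Res (laxL l x (lam l h₁ h₂) i j) (laxL l x a i j) := by
      intro i j
      have := hP.res_lam.aeval (laxL l x (X : ℂ[X]) i j)
      rw [← coe_aeval_eq_eval] at this
      have e1 := laxL_map l x (X : ℂ[X]) (aeval (lam l h₁ h₂))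
      have e2 := laxL_map l x (X : ℂ[X]) (aeval a)
      rw [aeval_X] at e1 e2
      rw [e1, e2]
      exact this
    have h1 := Place.Res.mulVec hL hu i
    rw [hψ] at h1
    exact h1.eq (hP.res_eta.mul (hu i))

/-- Eigenvectors of `L(a)` come from specializing `ψ`, so the characteristic polynomial of `L` never
has to be computed. -/
theorem exists_eigenvector {a b : ℂ} (hP : HasCoords P a b) (h : OnCurve l h₁ h₂ a b)
    (hb : 3 * b ^ 2 - l ^ 2 ≠ 0) (hψ0 : ψ ≠ 0)
    (hψ : (laxL l x (lam l h₁ h₂)).mulVec ψ = eta l h₁ h₂ • ψ) :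
    ∃ u : Fin 3 → ℂ, u ≠ 0 ∧ (laxL l x a).mulVec u = b • u := by
  obtain ⟨c, -, hc⟩ := exists_normalized P.v hψ0
  obtain ⟨u, hu, -, hLu⟩ := exists_res_eigenvector (x := x) hP h hb hc (by
    rw [Matrix.mulVec_smul, hψ, smul_comm])
  exact ⟨u, hu, hLu⟩

end Eigenvectors

/-! ### Local behaviour of the intertwining matrix -/

section Local

theorem intertwiner_apply_eq {R : Type*} [CommRing R] [Algebra ℂ R] (μ Y₁ Y₂ : ℂ) (t : R)
    (i j : Fin 3) : intertwiner μ Y₁ Y₂ t i j = algebraMap ℂ R (intertwiner μ Y₁ Y₂ (0 : ℂ) i j) +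
      algebraMap ℂ R (intertwiner μ Y₁ Y₂ (1 : ℂ) i j - intertwiner μ Y₁ Y₂ (0 : ℂ) i j) * t := by
  fin_cases i <;> fin_cases j <;>
    simp [intertwiner, map_ofNat (algebraMap ℂ R)] <;> ring

theorem cointertwiner_apply_eq {R : Type*} [CommRing R] [Algebra ℂ R] (μ Y₁ Y₂ : ℂ) (t : R)
    (i j : Fin 3) :
    cointertwiner μ Y₁ Y₂ t i j = algebraMap ℂ R (cointertwiner μ Y₁ Y₂ (0 : ℂ) i j) +
      algebraMap ℂ R (cointertwiner μ Y₁ Y₂ (1 : ℂ) i j - cointertwiner μ Y₁ Y₂ (0 : ℂ) i j)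
        * t := by
  fin_cases i <;> fin_cases j <;>
    simp [cointertwiner, map_ofNat (algebraMap ℂ R)]

theorem Place.v_const_add_const_mul_le {F : Type*} [Field F] [Algebra ℂ F] (P : Place F)
    (p q : ℂ) (t : F) : P.v (algebraMap ℂ F p + algebraMap ℂ F q * t) ≤ max 1 (P.v t) := by
  refine (P.v.map_add _ _).trans (max_le_max (P.v_const_le p) ?_)
  rw [map_mul]
  exact mul_le_of_le_one_left' (P.v_const_le q)

variable {l h₁ h₂ μ e b Y₁ Y₂ : ℂ} {P : Place (FunField l h₁ h₂)} {x : Phase}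
  {φ : Fin 3 → FunField l h₁ h₂} {u : Fin 3 → ℂ}

theorem v_intertwiner_le (i j : Fin 3) :
    P.v (intertwiner μ Y₁ Y₂ (lam l h₁ h₂) i j) ≤ max 1 (P.v (lam l h₁ h₂)) := by
  rw [intertwiner_apply_eq]
  exact P.v_const_add_const_mul_le _ _ _

theorem v_cointertwiner_le (i j : Fin 3) :
    P.v (cointertwiner μ Y₁ Y₂ (lam l h₁ h₂) i j) ≤ max 1 (P.v (lam l h₁ h₂)) := by
  rw [cointertwiner_apply_eq]
  exact P.v_const_add_const_mul_le _ _ _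

/-- `M` and its partner each have poles of order at most 3, while their product `μ² - λ²` has one of
order 6. Hence neither bound can be strict. -/
theorem vmax_intertwiner_of_isInfinity (h : IsInfinity P) :
    vmax P.v ((intertwiner μ Y₁ Y₂ (lam l h₁ h₂)).mulVec φ) = exp 3 * vmax P.v φ := by
  have hmax : max 1 (P.v (lam l h₁ h₂)) = exp 3 := by
    rw [max_eq_right (le_of_lt h), h.v_eq_exp.1]
  refine le_antisymm (vmax_mulVec_le (fun i j => hmax ▸ v_intertwiner_le i j) φ) ?_
  have h1 := vmax_le_mulVec (v := P.v) (fun i j => hmax ▸ v_cointertwiner_le i j)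
    (cointertwiner_mul_intertwiner μ Y₁ Y₂ (lam l h₁ h₂)) φ
  have h2 : P.v (algebraMap ℂ _ μ ^ 2 - lam l h₁ h₂ ^ 2) = exp 3 * exp 3 := by
    rw [P.v.map_sub_eq_of_lt_right, map_pow, h.v_eq_exp.1, pow_two]
    rw [← map_pow, map_pow P.v]
    exact (P.v_const_le _).trans_lt (one_lt_pow₀ h (by norm_num))
  rw [h2, mul_assoc] at h1
  exact le_of_mul_le_mul_left h1 exp_pos

theorem vmax_intertwiner_le (h : P.v (lam l h₁ h₂) ≤ 1) :
    vmax P.v ((intertwiner μ Y₁ Y₂ (lam l h₁ h₂)).mulVec φ) ≤ vmax P.v φ := by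
  have := vmax_mulVec_le (v := P.v) (r := 1)
    (fun i j => (max_eq_left h) ▸ v_intertwiner_le (μ := μ) (Y₁ := Y₁) (Y₂ := Y₂) i j) φ
  rwa [one_mul] at this

theorem le_vmax_intertwiner (h : P.v (lam l h₁ h₂) ≤ 1) :
    P.v (algebraMap ℂ _ μ - lam l h₁ h₂) * P.v (algebraMap ℂ _ μ + lam l h₁ h₂) * vmax P.v φ ≤
      vmax P.v ((intertwiner μ Y₁ Y₂ (lam l h₁ h₂)).mulVec φ) := by
  have := vmax_le_mulVec (v := P.v) (r := 1) (fun i j => (max_eq_left h) ▸ v_cointertwiner_le i j)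
    (cointertwiner_mul_intertwiner μ Y₁ Y₂ (lam l h₁ h₂)) φ
  rwa [one_mul, sq_sub_sq, mul_comm (_ + _), map_mul] at this

theorem vmax_intertwiner_of_v_eq_one (h : P.v (lam l h₁ h₂) ≤ 1)
    (h₁' : P.v (lam l h₁ h₂ - algebraMap ℂ _ μ) = 1)
    (h₂' : P.v (lam l h₁ h₂ + algebraMap ℂ _ μ) = 1) :
    vmax P.v ((intertwiner μ Y₁ Y₂ (lam l h₁ h₂)).mulVec φ) = vmax P.v φ := by
  refine le_antisymm (vmax_intertwiner_le h) ?_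
  have := le_vmax_intertwiner (μ := μ) (Y₁ := Y₁) (Y₂ := Y₂) (φ := φ) h
  rwa [P.v.map_sub_swap, h₁', add_comm, h₂', one_mul, one_mul] at this

theorem HasCoords.res_intertwiner_mulVec {a : ℂ} (hP : HasCoords P a b)
    (hu : ∀ i, P.Res (φ i) (u i)) (i : Fin 3) :
    P.Res ((intertwiner μ Y₁ Y₂ (lam l h₁ h₂)).mulVec φ i)
      ((intertwiner μ Y₁ Y₂ a).mulVec u i) := by
  refine Place.Res.mulVec (fun i j => ?_) hu i
  rw [intertwiner_apply_eq, intertwiner_apply_eq μ Y₁ Y₂ a]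
  exact (P.res_const _).add ((P.res_const _).mul hP.res_lam)

/-- At `-μ` the matrix is a column times the row `(μ, -Y₂, Y₁)`, so its vanishing on `u` is a single
linear condition. -/
theorem intertwiner_mulVec_neg (μ Y₁ Y₂ : ℂ) (u : Fin 3 → ℂ) :
    (intertwiner μ Y₁ Y₂ (-μ)).mulVec u =
      (2 * (μ * u 0 - Y₂ * u 1 + Y₁ * u 2)) • ![1, -Y₁, -(Y₂ - 2 * Y₁ ^ 2)] := by
  obtain ⟨e0, e1, e2⟩ := intertwiner_mulVec_apply μ Y₁ Y₂ (-μ) u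
  simp only [Algebra.algebraMap_self, RingHom.id_apply] at e0 e1 e2
  funext i
  fin_cases i
  · simp [e0]; ring
  · simp [e0, e1]; ring
  · simp [e0, e2]; ring

theorem intertwiner_mulVec_eigenvector (μ Y₁ Y₂ k : ℂ) :
    (intertwiner μ Y₁ Y₂ μ).mulVec (k • ![1, Y₁, Y₂]) = 0 := by
  obtain ⟨e0, e1, e2⟩ := intertwiner_mulVec_apply μ Y₁ Y₂ μ (k • ![1, Y₁, Y₂])
  simp [-Matrix.smul_cons] at e0 e1 e2
  funext i
  fin_cases i
  · simp [-Matrix.smul_cons, e0]; ring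
  · simp [-Matrix.smul_cons, e0, e1]; ring
  · simp [-Matrix.smul_cons, e0, e2]; ring

theorem eq_smul_of_intertwiner_mulVec_eq_zero (hμ : μ ≠ 0)
    (h : (intertwiner μ Y₁ Y₂ μ).mulVec u = 0) : u = u 0 • ![1, Y₁, Y₂] := by
  obtain ⟨-, e1, e2⟩ := intertwiner_mulVec_apply μ Y₁ Y₂ μ u
  simp only [Algebra.algebraMap_self, RingHom.id_apply, h, Pi.zero_apply, mul_zero, sub_zero,
    ← two_mul] at e1 e2
  have h2 : 2 * μ ≠ 0 := mul_ne_zero two_ne_zero hμ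
  have h1 := (mul_eq_zero.1 e1.symm).resolve_left h2
  have h3 := (mul_eq_zero.1 e2.symm).resolve_left h2
  funext i
  fin_cases i
  · simp
  · simp; linear_combination -h1
  · simp; linear_combination -h3 - 2 * Y₁ * h1

/-- The vector `(μ, -Y₂, Y₁)` is a left eigenvector of `L(-μ)`. -/
theorem left_eigenvector (hY : (laxL l x μ).mulVec ![1, Y₁, Y₂] = e • ![1, Y₁, Y₂])
    (hu : (laxL l x (-μ)).mulVec u = b • u) :
    (b + e) * (μ * u 0 - Y₂ * u 1 + Y₁ * u 2) = 0 := by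
  obtain ⟨y0, y1, y2⟩ := (laxL_mulVec_eq_smul_iff l x _ _ _).1 hY
  obtain ⟨u0, u1, u2⟩ := (laxL_mulVec_eq_smul_iff l x _ _ _).1 hu
  simp only [Algebra.algebraMap_self, RingHom.id_apply, Matrix.cons_val_zero,
    Matrix.cons_val_one, Matrix.cons_val] at y0 y1 y2 u0 u1 u2
  -- `L(μ)` and `-L(-μ)` are adjoint for the pairing `μ y₀ u₀ - y₂ u₁ + y₁ u₂`, taken here at `y =
  -- (1, Y₁, Y₂)`.
  linear_combination -(μ * u0 - Y₂ * u1 + Y₁ * u2) - μ * u 0 * y0 + u 1 * y2 - u 2 * y1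

/-! #### Points over `μ ≠ 0` -/

theorem vmax_intertwiner_of_ne (hP : HasCoords P μ b) (hμ : μ ≠ 0)
    (hY : (laxL l x μ).mulVec ![1, Y₁, Y₂] = e • ![1, Y₁, Y₂])
    (hu0 : u ≠ 0) (hu : ∀ i, P.Res (φ i) (u i)) (hLu : (laxL l x μ).mulVec u = b • u)
    (hb : b ≠ e) : vmax P.v ((intertwiner μ Y₁ Y₂ (lam l h₁ h₂)).mulVec φ) = 1 := by
  refine vmax_eq_one_of_res (hP.res_intertwiner_mulVec hu) fun h => ?_
  have hu' := eq_smul_of_intertwiner_mulVec_eq_zero hμ h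
  rw [hu', Matrix.mulVec_smul, hY, smul_comm, ← sub_eq_zero, ← sub_smul, ← hu'] at hLu
  exact (smul_ne_zero (sub_ne_zero.2 hb.symm) hu0) hLu

/-- The residue of `φ` lies in the kernel of `M(μ)`, and the zero is simple because `μ² - λ²` has
only a simple zero at an unramified point over `μ ≠ 0`. -/
theorem vmax_intertwiner_of_eq_smul (hP : HasCoords P μ b) (hc : OnCurve l h₁ h₂ μ b)
    (hb : 3 * b ^ 2 - l ^ 2 ≠ 0) (hμ : μ ≠ 0) (hφ : vmax P.v φ = 1)
    (hu : ∀ i, P.Res (φ i) (u i)) {k : ℂ} (hk : u = k • ![1, Y₁, Y₂]) :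
    vmax P.v ((intertwiner μ Y₁ Y₂ (lam l h₁ h₂)).mulVec φ) = exp (-1) := by
  refine le_antisymm (vmax_le_exp_neg_one_of_res (hP.res_intertwiner_mulVec hu) ?_) ?_
  · rw [hk, intertwiner_mulVec_eigenvector]
  · have := le_vmax_intertwiner (μ := μ) (Y₁ := Y₁) (Y₂ := Y₂) (φ := φ) hP.res_lam.v_le_one
    rwa [P.v.map_sub_swap, hP.v_lam_sub hc hb, hφ, mul_one,
      ((P.res_const μ).add hP.res_lam).v_eq_one (by simpa using hμ), mul_one] at this

/-! #### Points over `-μ ≠ 0` -/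

theorem vmax_intertwiner_neg_of_ne (hP : HasCoords P (-μ) b) (hc : OnCurve l h₁ h₂ (-μ) b)
    (hb : 3 * b ^ 2 - l ^ 2 ≠ 0) (hμ : μ ≠ 0) (hφ : vmax P.v φ = 1)
    (hu : ∀ i, P.Res (φ i) (u i)) (hw : μ * u 0 - Y₂ * u 1 + Y₁ * u 2 = 0) :
    vmax P.v ((intertwiner μ Y₁ Y₂ (lam l h₁ h₂)).mulVec φ) = exp (-1) := by
  refine le_antisymm (vmax_le_exp_neg_one_of_res (hP.res_intertwiner_mulVec hu) ?_) ?_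
  · rw [intertwiner_mulVec_neg, hw, mul_zero, zero_smul]
  · have := le_vmax_intertwiner (μ := μ) (Y₁ := Y₁) (Y₂ := Y₂) (φ := φ) hP.res_lam.v_le_one
    have h1 := hP.v_lam_sub hc hb
    rw [map_neg, sub_neg_eq_add, add_comm] at h1
    rwa [h1, ((P.res_const μ).sub hP.res_lam).v_eq_one (by simpa using hμ), hφ, mul_one,
      one_mul] at this

theorem vmax_intertwiner_neg_of_left_ne_zero (hP : HasCoords P (-μ) b)
    (hu : ∀ i, P.Res (φ i) (u i)) (hw : μ * u 0 - Y₂ * u 1 + Y₁ * u 2 ≠ 0) :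
    vmax P.v ((intertwiner μ Y₁ Y₂ (lam l h₁ h₂)).mulVec φ) = 1 := by
  refine vmax_eq_one_of_res (hP.res_intertwiner_mulVec hu) ?_
  rw [intertwiner_mulVec_neg]
  exact smul_ne_zero (mul_ne_zero two_ne_zero hw) fun h => by simpa using congrFun h 0

/-! #### Points over `μ = 0` -/

/-- A null vector of `L(0)` is a multiple of the first basis vector. -/
theorem apply_eq_zero_of_laxL_zero (hl : l ≠ 0) (h : (laxL l x (0 : ℂ)).mulVec u = (0 : ℂ) • u) :
    u 1 = 0 ∧ u 2 = 0 := by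
  obtain ⟨-, e1, e2⟩ := (laxL_mulVec_eq_smul_iff l x _ _ _).1 h
  simp only [Algebra.algebraMap_self, RingHom.id_apply] at e1 e2
  have hq := x.q₂_ne_zero
  have h1 : l ^ 2 * u 1 = 0 := by
    field_simp at e2
    linear_combination e2 / 2 - x.q₂ * x.p₂ * e1
  have h1 := (mul_eq_zero.1 h1).resolve_left (pow_ne_zero 2 hl)
  refine ⟨h1, ?_⟩
  rw [h1] at e1
  have : x.q₂ ^ 2 * u 2 = 0 := by linear_combination e1
  exact (mul_eq_zero.1 this).resolve_left (pow_ne_zero 2 hq)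

theorem vmax_intertwiner_zero_zero (hP : HasCoords P 0 b) (hc : OnCurve l h₁ h₂ 0 b)
    (hb : 3 * b ^ 2 - l ^ 2 ≠ 0) (hl : l ≠ 0) (hφ : vmax P.v φ = 1)
    (hY : (laxL l x (0 : ℂ)).mulVec ![1, Y₁, Y₂] = (0 : ℂ) • ![1, Y₁, Y₂]) :
    vmax P.v ((intertwiner 0 Y₁ Y₂ (lam l h₁ h₂)).mulVec φ) = exp (-1) := by
  obtain ⟨hY1, hY2⟩ := apply_eq_zero_of_laxL_zero hl hY
  obtain rfl : Y₁ = 0 := by simpa using hY1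
  obtain rfl : Y₂ = 0 := by simpa using hY2
  -- The null vector forces `Y₁ = Y₂ = 0`, so `M` is the scalar `-λ`.
  have hM : intertwiner 0 0 0 (lam l h₁ h₂) = (-lam l h₁ h₂) • 1 := by
    ext i j
    fin_cases i <;> fin_cases j <;> simp [intertwiner]
  have hv := hP.v_lam_sub hc hb
  rw [map_zero, sub_zero] at hv
  rw [hM, Matrix.smul_mulVec, Matrix.one_mulVec, vmax_smul, hφ, mul_one, P.v.map_neg, hv]

theorem Y₁_ne_zero (he : e ≠ 0)
    (hY : (laxL l x (0 : ℂ)).mulVec ![1, Y₁, Y₂] = e • ![1, Y₁, Y₂]) : Y₁ ≠ 0 := by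
  rintro rfl
  obtain ⟨y0, y1, -⟩ := (laxL_mulVec_eq_smul_iff l x _ _ _).1 hY
  simp only [Algebra.algebraMap_self, RingHom.id_apply, Matrix.cons_val_zero,
    Matrix.cons_val_one, Matrix.cons_val] at y0 y1
  have : x.q₂ ^ 2 * Y₂ = 0 := by linear_combination y1
  have := (mul_eq_zero.1 this).resolve_left (pow_ne_zero 2 x.q₂_ne_zero)
  rw [this] at y0
  apply he
  linear_combination -y0

/-- The factor `-λ²` alone would allow a double zero. The second row excludes it: modulo the first
component it is `λ (Y₁ φ₀ - φ₁)`, whose bracket has the nonzero residue `Y₁ u₀`. -/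
theorem vmax_intertwiner_zero_of_eq_zero (hP : HasCoords P 0 0) (hc : OnCurve l h₁ h₂ 0 0)
    (hl : l ≠ 0) (he : e ≠ 0)
    (hY : (laxL l x (0 : ℂ)).mulVec ![1, Y₁, Y₂] = e • ![1, Y₁, Y₂])
    (hu0 : u ≠ 0) (hu : ∀ i, P.Res (φ i) (u i))
    (hLu : (laxL l x (0 : ℂ)).mulVec u = (0 : ℂ) • u) :
    vmax P.v ((intertwiner 0 Y₁ Y₂ (lam l h₁ h₂)).mulVec φ) = exp (-1) := by
  obtain ⟨hu1, hu2⟩ := apply_eq_zero_of_laxL_zero hl hLu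
  have hu00 : u 0 ≠ 0 := by
    intro h
    apply hu0
    funext i
    fin_cases i <;> simp [h, hu1, hu2]
  have hv := hP.v_lam_sub hc (by simpa using hl)
  rw [map_zero, sub_zero] at hv
  refine le_antisymm (vmax_le_exp_neg_one_of_res (hP.res_intertwiner_mulVec hu) ?_) ?_
  · have := intertwiner_mulVec_neg 0 Y₁ Y₂ u
    rw [neg_zero] at this
    rw [this, hu1, hu2]
    simp
  · obtain ⟨-, e1, -⟩ := intertwiner_mulVec_apply 0 Y₁ Y₂ (lam l h₁ h₂) φ
    rw [map_zero, add_zero] at e1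
    have h1 : P.Res (algebraMap ℂ _ Y₁ * φ 0 - φ 1) (Y₁ * u 0 - u 1) :=
      ((P.res_const _).mul (hu 0)).sub (hu 1)
    have h2 := h1.v_eq_one (by simpa [hu1] using And.intro (Y₁_ne_zero he hY) hu00)
    rw [← hv, ← mul_one (P.v (lam l h₁ h₂)), ← h2, ← map_mul, sub_eq_iff_eq_add.1 e1.symm]
    refine (P.v.map_add _ _).trans (max_le (le_vmax _ 1) ?_)
    rw [map_mul]
    exact (mul_le_of_le_one_left' (P.v_const_le _)).trans (le_vmax _ 0)

/-- Here `Q_α` coincides with one of the points `υ(Q_β)`, `υ(Q_γ)`, and the zero is double. The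
factor `-λ²` bounds the order by 2, so what needs proof is second-order vanishing of the first
component; the other two then follow. -/
theorem vmax_intertwiner_zero_of_eq (hP : HasCoords P 0 e) (hc : OnCurve l h₁ h₂ 0 e)
    (hb : 3 * e ^ 2 - l ^ 2 ≠ 0) (he : e ≠ 0)
    (hY : (laxL l x (0 : ℂ)).mulVec ![1, Y₁, Y₂] = e • ![1, Y₁, Y₂])
    (hφ : vmax P.v φ = 1) (hLφ : (laxL l x (lam l h₁ h₂)).mulVec φ = eta l h₁ h₂ • φ)
    (hu : ∀ i, P.Res (φ i) (u i)) {k : ℂ} (hk : u = k • ![1, Y₁, Y₂]) :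
    vmax P.v ((intertwiner 0 Y₁ Y₂ (lam l h₁ h₂)).mulVec φ) = exp (-2) := by
  have hv := hP.v_lam_sub hc hb
  rw [map_zero, sub_zero] at hv
  have hexp : (exp (-1) * exp (-1) : ℤᵐ⁰) = exp (-2) := by rw [← exp_add]; norm_num
  have hmul : ∀ {f : FunField l h₁ h₂}, P.Res f 0 → P.v (lam l h₁ h₂ * f) ≤ exp (-2) := by
    intro f hf
    rw [map_mul, hv, ← hexp]
    exact mul_le_mul_right (le_exp_neg_one (Place.res_zero_iff.1 hf)) _
  have hk0 : u 0 = k := by simp [hk]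
  have hk1 : u 1 = k * Y₁ := by simp [hk]
  have hk2 : u 2 = k * Y₂ := by simp [hk]
  obtain ⟨m0, m1, m2⟩ := intertwiner_mulVec_apply 0 Y₁ Y₂ (lam l h₁ h₂) φ
  rw [map_zero, add_zero] at m1 m2
  refine le_antisymm ?_ ?_
  · have h0 : P.v ((intertwiner 0 Y₁ Y₂ (lam l h₁ h₂)).mulVec φ 0) ≤ exp (-2) := by
      obtain ⟨y0, y1, y2⟩ := (laxL_mulVec_eq_smul_iff l x _ _ _).1 hY
      have y1' := congrArg (algebraMap ℂ (FunField l h₁ h₂)) y1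
      have y2' := congrArg (algebraMap ℂ (FunField l h₁ h₂)) y2
      obtain ⟨-, f1, f2⟩ := (laxL_mulVec_eq_smul_iff l x _ _ _).1 hLφ
      simp only [Algebra.algebraMap_self, RingHom.id_apply, Matrix.cons_val_zero,
        Matrix.cons_val_one, Matrix.cons_val] at y0 y1' y2'
      simp only [map_add, map_mul, map_sub, map_zero, map_pow, map_neg, map_ofNat]
        at m0 y1' y2' f1 f2
      -- The left eigenvector identity one order further in `λ`: pairing the equation of `φ` at `λ`
      -- with that of `(1, Y₁, Y₂)` at `0` extracts a factor `λ`.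
      have key : (eta l h₁ h₂ + algebraMap ℂ _ e) *
          (intertwiner 0 Y₁ Y₂ (lam l h₁ h₂)).mulVec φ 0 =
          lam l h₁ h₂ * (-(eta l h₁ h₂ + algebraMap ℂ _ e) * φ 0 +
            algebraMap ℂ _ 2 * (-algebraMap ℂ _ Y₂ * ((algebraMap ℂ _ 9 * lam l h₁ h₂ +
              algebraMap ℂ _ (3 * x.p₁)) * φ 0 - algebraMap ℂ _ (3 * x.q₁) * φ 1) +
            algebraMap ℂ _ Y₁ * (-algebraMap ℂ _ ((3 * x.q₁ ^ 2 + x.q₂ ^ 2) / 2) * φ 0 +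
              algebraMap ℂ _ 9 * lam l h₁ h₂ * φ 1 - algebraMap ℂ _ (3 * x.q₁) * φ 2))) := by
        rw [m0]
        simp only [map_mul, map_ofNat]
        linear_combination 2 * algebraMap ℂ _ Y₂ * f1 - 2 * algebraMap ℂ _ Y₁ * f2
          + 2 * φ 1 * y2' - 2 * φ 2 * y1'
      have hres : P.Res (-(eta l h₁ h₂ + algebraMap ℂ _ e) * φ 0 +
            algebraMap ℂ _ 2 * (-algebraMap ℂ _ Y₂ * ((algebraMap ℂ _ 9 * lam l h₁ h₂ +
              algebraMap ℂ _ (3 * x.p₁)) * φ 0 - algebraMap ℂ _ (3 * x.q₁) * φ 1) +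
            algebraMap ℂ _ Y₁ * (-algebraMap ℂ _ ((3 * x.q₁ ^ 2 + x.q₂ ^ 2) / 2) * φ 0 +
              algebraMap ℂ _ 9 * lam l h₁ h₂ * φ 1 - algebraMap ℂ _ (3 * x.q₁) * φ 2)))
          (-(e + e) * u 0 + 2 * (-Y₂ * ((9 * 0 + 3 * x.p₁) * u 0 - 3 * x.q₁ * u 1) +
            Y₁ * (-((3 * x.q₁ ^ 2 + x.q₂ ^ 2) / 2) * u 0 + 9 * 0 * u 1 - 3 * x.q₁ * u 2))) := by
        have c := P.res_const
        have hl := hP.res_lam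
        exact ((hP.res_eta.add (c e)).neg.mul (hu 0)).add ((c 2).mul (((c Y₂).neg.mul
          (((((c 9).mul hl).add (c _)).mul (hu 0)).sub ((c _).mul (hu 1)))).add
          ((c Y₁).mul ((((c _).neg.mul (hu 0)).add (((c 9).mul hl).mul (hu 1))).sub
            ((c _).mul (hu 2))))))
      -- The remaining factor vanishes at `P` by the first row of the eigenvector equation at `0`.
      have hzero : (-(e + e) * u 0 + 2 * (-Y₂ * ((9 * 0 + 3 * x.p₁) * u 0 - 3 * x.q₁ * u 1) +
            Y₁ * (-((3 * x.q₁ ^ 2 + x.q₂ ^ 2) / 2) * u 0 + 9 * 0 * u 1 - 3 * x.q₁ * u 2))) = 0 := by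
        rw [hk0, hk1, hk2]
        linear_combination 2 * k * y0
      rw [hzero] at hres
      have h1 := hmul hres
      rw [← key, map_mul, (hP.res_eta.add (P.res_const e)).v_eq_one
        (by simpa [← two_mul] using he), one_mul] at h1
      exact h1
    refine vmax_le_iff.2 fun i => ?_
    fin_cases i
    · exact h0
    · change P.v ((intertwiner 0 Y₁ Y₂ (lam l h₁ h₂)).mulVec φ 1) ≤ _
      rw [m1]
      refine P.v.map_sub_le (hmul ?_) ?_
      · have := ((P.res_const Y₁).mul (hu 0)).sub (hu 1)
        rwa [hk0, hk1, show Y₁ * k - k * Y₁ = 0 by ring] at this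
      · rw [map_mul]
        exact (mul_le_of_le_one_left' (P.v_const_le _)).trans h0
    · change P.v ((intertwiner 0 Y₁ Y₂ (lam l h₁ h₂)).mulVec φ 2) ≤ _
      rw [m2]
      refine P.v.map_sub_le (hmul ?_) ?_
      · have := (((P.res_const (Y₂ - 2 * Y₁ ^ 2)).mul (hu 0)).add
          ((P.res_const (2 * Y₁)).mul (hu 1))).sub (hu 2)
        rwa [hk0, hk1, hk2, show (Y₂ - 2 * Y₁ ^ 2) * k + 2 * Y₁ * (k * Y₁) - k * Y₂ = 0 by ring]
          at this
      · rw [map_mul]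
        exact (mul_le_of_le_one_left' (P.v_const_le _)).trans h0
  · have := le_vmax_intertwiner (μ := 0) (Y₁ := Y₁) (Y₂ := Y₂) (φ := φ) hP.res_lam.v_le_one
    rwa [map_zero, zero_sub, zero_add, P.v.map_neg, hv, hφ, mul_one, hexp] at this

theorem vmax_intertwiner_zero_of_eq_neg (hP : HasCoords P 0 (-e)) (he : e ≠ 0)
    (hY : (laxL l x (0 : ℂ)).mulVec ![1, Y₁, Y₂] = e • ![1, Y₁, Y₂])
    (hu0 : u ≠ 0) (hu : ∀ i, P.Res (φ i) (u i)) (hLu : (laxL l x (0 : ℂ)).mulVec u = (-e) • u) :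
    vmax P.v ((intertwiner 0 Y₁ Y₂ (lam l h₁ h₂)).mulVec φ) = 1 := by
  have hP' : HasCoords P (-0) (-e) := by rwa [neg_zero]
  refine vmax_intertwiner_neg_of_left_ne_zero hP' hu fun hw => hu0 ?_
  have hY1 := Y₁_ne_zero he hY
  obtain ⟨-, y1, -⟩ := (laxL_mulVec_eq_smul_iff l x _ _ _).1 hY
  obtain ⟨u0, u1, u2⟩ := (laxL_mulVec_eq_smul_iff l x _ _ _).1 hLu
  simp only [Algebra.algebraMap_self, RingHom.id_apply, Matrix.cons_val_zero,
    Matrix.cons_val_one, Matrix.cons_val] at y1 u0 u1 u2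
  -- Second rows for the eigenvalues `e` and `-e`, combined with the assumed vanishing of `-Y₂ u₁ +
  -- Y₁ u₂`.
  have h1 : 2 * e * Y₁ * u 1 = 0 := by
    linear_combination Y₁ * u1 - u 1 * y1 - x.q₂ ^ 2 * hw
  have h1 : u 1 = 0 := by simpa [he, hY1] using h1
  have h2 : Y₁ * u 2 = 0 := by rw [h1] at hw; linear_combination hw
  have h2 := (mul_eq_zero.1 h2).resolve_left hY1
  have h0 : e * u 0 = 0 := by rw [h1, h2] at u0; linear_combination u0
  have h0 := (mul_eq_zero.1 h0).resolve_left he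
  funext i
  fin_cases i <;> simp [h0, h1, h2]

end Local

/-! ### The divisor of the intertwining matrix -/

section Fibre

variable {l h₁ h₂ a r₁ r₂ r₃ : ℂ}

theorem fin_three_cases (α β γ i : Fin 3) (hαβ : α ≠ β) (hαγ : α ≠ γ) (hβγ : β ≠ γ) :
    i = α ∨ i = β ∨ i = γ := by
  decide +revert

/-- Vieta's relations between the values of `η` at three points over the same `λ`. -/
theorem vieta (h1 : OnCurve l h₁ h₂ a r₁) (h2 : OnCurve l h₁ h₂ a r₂) (h3 : OnCurve l h₁ h₂ a r₃)
    (h12 : r₁ ≠ r₂) (h13 : r₁ ≠ r₃) (h23 : r₂ ≠ r₃) :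
    r₁ + r₂ + r₃ = 0 ∧ r₁ * r₂ + r₁ * r₃ + r₂ * r₃ = -l ^ 2 ∧
      r₁ * r₂ * r₃ = (rhs h₁ h₂).eval a := by
  have hr : (rhs h₁ h₂).eval a = r₁ ^ 3 - l ^ 2 * r₁ := by
    unfold OnCurve at h1
    simp only [rhs, eval_add, eval_sub, eval_mul, eval_pow, eval_C, eval_X]
    linear_combination -h1
  unfold OnCurve at h1 h2 h3
  have e12 : r₁ ^ 2 + r₁ * r₂ + r₂ ^ 2 = l ^ 2 := by
    refine mul_left_cancel₀ (sub_ne_zero.2 h12) ?_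
    linear_combination h1 - h2
  have e13 : r₁ ^ 2 + r₁ * r₃ + r₃ ^ 2 = l ^ 2 := by
    refine mul_left_cancel₀ (sub_ne_zero.2 h13) ?_
    linear_combination h1 - h3
  have hs : r₁ + r₂ + r₃ = 0 := by
    refine (mul_eq_zero.1 ?_).resolve_left (sub_ne_zero.2 h23)
    linear_combination e12 - e13
  obtain rfl : r₃ = -r₁ - r₂ := by linear_combination hs
  refine ⟨hs, by linear_combination -e12, ?_⟩
  rw [hr]
  linear_combination -r₁ * e12

theorem unramified (h1 : OnCurve l h₁ h₂ a r₁) (h2 : OnCurve l h₁ h₂ a r₂)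
    (h3 : OnCurve l h₁ h₂ a r₃) (h12 : r₁ ≠ r₂) (h13 : r₁ ≠ r₃) (h23 : r₂ ≠ r₃) :
    3 * r₁ ^ 2 - l ^ 2 ≠ 0 := by
  obtain ⟨hs, hp, -⟩ := vieta h1 h2 h3 h12 h13 h23
  have : 3 * r₁ ^ 2 - l ^ 2 = (r₁ - r₂) * (r₁ - r₃) := by
    linear_combination 2 * r₁ * hs - hp
  rw [this]
  exact mul_ne_zero (sub_ne_zero.2 h12) (sub_ne_zero.2 h13)

theorem OnCurve.neg {b : ℂ} (h : OnCurve l h₁ h₂ a b) : OnCurve l h₁ h₂ (-a) (-b) := by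
  unfold OnCurve at h ⊢
  linear_combination -h

theorem HasCoords.map_upsilon {P : Place (FunField l h₁ h₂)} {b : ℂ} (hP : HasCoords P a b) :
    HasCoords (P.map (upsilon l h₁ h₂)) (-a) (-b) := by
  constructor
  · change P.v (upsilon l h₁ h₂ (lam l h₁ h₂ - algebraMap ℂ _ (-a))) < 1
    rw [map_sub, upsilon_lam, AlgEquiv.commutes, map_neg, ← neg_sub', P.v.map_neg]
    exact hP.1
  · change P.v (upsilon l h₁ h₂ (eta l h₁ h₂ - algebraMap ℂ _ (-b))) < 1
    rw [map_sub, upsilon_eta, AlgEquiv.commutes, map_neg, ← neg_sub', P.v.map_neg]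
    exact hP.2

theorem IsInfinity.map_upsilon {P : Place (FunField l h₁ h₂)} (hP : IsInfinity P) :
    IsInfinity (P.map (upsilon l h₁ h₂)) := by
  change 1 < P.v (upsilon l h₁ h₂ (lam l h₁ h₂))
  rw [upsilon_lam, P.v.map_neg]
  exact hP

/-- By Vieta the product of the `η - rᵢ` is the difference of the right-hand sides at `λ` and at
`a`. It vanishes at `P`, so one factor does. -/
theorem hasCoords_of_res_lam {P : Place (FunField l h₁ h₂)} (h1 : OnCurve l h₁ h₂ a r₁)
    (h2 : OnCurve l h₁ h₂ a r₂) (h3 : OnCurve l h₁ h₂ a r₃)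
    (h12 : r₁ ≠ r₂) (h13 : r₁ ≠ r₃) (h23 : r₂ ≠ r₃) (hP : P.Res (lam l h₁ h₂) a) :
    HasCoords P a r₁ ∨ HasCoords P a r₂ ∨ HasCoords P a r₃ := by
  obtain ⟨hs, hp, hr⟩ := vieta h1 h2 h3 h12 h13 h23
  have hη := v_eta_le_one hP.v_le_one
  have hle : ∀ r : ℂ, P.v (eta l h₁ h₂ - algebraMap ℂ _ r) ≤ 1 := fun r =>
    P.v.map_sub_le hη (P.v_const_le r)
  by_contra! hcon
  have hge : ∀ r, ¬ HasCoords P a r → P.v (eta l h₁ h₂ - algebraMap ℂ _ r) = 1 := fun r hn =>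
    (hle r).antisymm (not_lt.1 fun hlt => hn ⟨hP, hlt⟩)
  have hprod : (eta l h₁ h₂ - algebraMap ℂ _ r₁) * (eta l h₁ h₂ - algebraMap ℂ _ r₂) *
      (eta l h₁ h₂ - algebraMap ℂ _ r₃) =
      aeval (lam l h₁ h₂) (rhs h₁ h₂) - algebraMap ℂ _ ((rhs h₁ h₂).eval a) := by
    have hs' := congrArg (algebraMap ℂ (FunField l h₁ h₂)) hs
    have hp' := congrArg (algebraMap ℂ (FunField l h₁ h₂)) hp
    rw [← eta_eq, ← hr]
    simp only [map_add, map_mul, map_zero, map_neg, map_pow] at hs' hp' ⊢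
    linear_combination -eta l h₁ h₂ ^ 2 * hs' + eta l h₁ h₂ * hp'
  have hlt : P.v ((eta l h₁ h₂ - algebraMap ℂ _ r₁) * (eta l h₁ h₂ - algebraMap ℂ _ r₂) *
      (eta l h₁ h₂ - algebraMap ℂ _ r₃)) < 1 := by
    rw [hprod]
    exact hP.aeval _
  rw [map_mul, map_mul, hge _ hcon.1, hge _ hcon.2.1, hge _ hcon.2.2] at hlt
  simp at hlt

open Classical in
theorem pt_apply_of_hasCoords {P Q : Place (FunField l h₁ h₂)} {b a' b' : ℂ}
    (hQ : HasCoords Q a b) (hP : HasCoords P a' b') (hc : OnCurve l h₁ h₂ a b)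
    (hb : 3 * b ^ 2 - l ^ 2 ≠ 0) : pt Q P = if a' = a ∧ b' = b then 1 else 0 := by
  unfold pt
  rw [Finsupp.single_apply]
  refine if_congr ⟨?_, ?_⟩ rfl rfl
  · rintro rfl
    exact ⟨hP.res_lam.eq hQ.res_lam, hP.res_eta.eq hQ.res_eta⟩
  · rintro ⟨rfl, rfl⟩
    exact hQ.unique hP hc hb

theorem pt_apply_of_not_res {P Q : Place (FunField l h₁ h₂)} {b : ℂ}
    (hQ : HasCoords Q a b) (hP : ¬ P.Res (lam l h₁ h₂) a) : pt Q P = 0 := by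
  classical
  unfold pt
  rw [Finsupp.single_apply, if_neg]
  rintro rfl
  exact hP hQ.res_lam

theorem pt_infinity_apply {P infty : Place (FunField l h₁ h₂)} (h : IsInfinity infty)
    (hP : P.v (lam l h₁ h₂) ≤ 1) : pt infty P = 0 := by
  classical
  unfold pt
  rw [Finsupp.single_apply, if_neg]
  rintro rfl
  exact absurd hP (not_le.2 h)

end Fibre

/-! ### The shift of the pole divisor and its class -/

section Shift

variable {l h₁ h₂ μ : ℂ} {e : Fin 3 → ℂ} {Q : Fin 3 → Place (FunField l h₁ h₂)}
  {infty P : Place (FunField l h₁ h₂)} {α β γ : Fin 3} {x : Phase} {Y₁ Y₂ a b : ℂ}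
  {ψ : Fin 3 → FunField l h₁ h₂}

open Classical in
/-- The order of vanishing of the intertwining matrix on an eigenvector at a point with
coordinates `(a, b)`. -/
def vanishingOrder (μ A B C a b : ℂ) : ℤ :=
  (if a = μ ∧ b = A then 1 else 0) + (if a = -μ ∧ b = -B then 1 else 0) +
    (if a = -μ ∧ b = -C then 1 else 0)

theorem unramified_of_injective (he : ∀ i, OnCurve l h₁ h₂ μ (e i))
    (he_inj : Function.Injective e) (i : Fin 3) : 3 * e i ^ 2 - l ^ 2 ≠ 0 :=
  unramified (he i) (he (i + 1)) (he (i + 2)) (he_inj.ne (by decide +revert))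
    (he_inj.ne (by decide +revert)) (he_inj.ne (by decide +revert))

/-- The eigenvectors of `L(μ)` for the eigenvalue `e α` are multiples of `(1, Y₁, Y₂)`. -/
theorem eq_smul_of_eigenvector (he : ∀ i, OnCurve l h₁ h₂ μ (e i))
    (he_inj : Function.Injective e) (hQ : ∀ i, HasCoords (Q i) μ (e i)) (hψ0 : ψ ≠ 0)
    (hψ : (laxL l x (lam l h₁ h₂)).mulVec ψ = eta l h₁ h₂ • ψ)
    (hY : (laxL l x μ).mulVec ![1, Y₁, Y₂] = e α • ![1, Y₁, Y₂]) {u : Fin 3 → ℂ}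
    (hu : (laxL l x μ).mulVec u = e α • u) : ∃ k : ℂ, u = k • ![1, Y₁, Y₂] := by
  have hfam : ∀ i, ∃ w : Fin 3 → ℂ, w ≠ 0 ∧ (laxL l x μ).mulVec w = e i • w ∧
      (i = α → w = ![1, Y₁, Y₂]) := by
    intro i
    by_cases hi : i = α
    · subst hi
      exact ⟨_, fun h => by simpa using congrFun h 0, hY, fun _ => rfl⟩
    · obtain ⟨w, hw0, hw⟩ := exists_eigenvector (hQ i) (he i)
        (unramified_of_injective he he_inj i) hψ0 hψ
      exact ⟨w, hw0, hw, fun h => absurd h hi⟩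
  choose w hw0 hw hwα using hfam
  rw [← hwα α rfl]
  exact exists_eq_smul_eigenvector he_inj hw0 hw hu

/-- For `μ ≠ 0` the left eigenvector `(μ, -Y₂, Y₁)` of `L(-μ)` does not annihilate the
eigenvectors for the same eigenvalue. -/
theorem left_ne_zero (he : ∀ i, OnCurve l h₁ h₂ μ (e i))
    (he_inj : Function.Injective e) (hQ : ∀ i, HasCoords (Q i) μ (e i)) (hψ0 : ψ ≠ 0)
    (hψ : (laxL l x (lam l h₁ h₂)).mulVec ψ = eta l h₁ h₂ • ψ) (hμ : μ ≠ 0)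
    (hY : (laxL l x μ).mulVec ![1, Y₁, Y₂] = e α • ![1, Y₁, Y₂]) {u : Fin 3 → ℂ} (hu0 : u ≠ 0)
    (hu : (laxL l x (-μ)).mulVec u = (-e α) • u) : μ * u 0 - Y₂ * u 1 + Y₁ * u 2 ≠ 0 := by
  intro hwu
  have hfam : ∀ i, ∃ w : Fin 3 → ℂ, w ≠ 0 ∧ (laxL l x (-μ)).mulVec w = (-e i) • w ∧
      μ * w 0 - Y₂ * w 1 + Y₁ * w 2 = 0 := by
    intro i
    by_cases hi : i = α
    · subst hi
      exact ⟨u, hu0, hu, hwu⟩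
    · obtain ⟨w, hw0, hw⟩ := exists_eigenvector (hQ i).map_upsilon (he i).neg
        (by simpa using unramified_of_injective he he_inj i) hψ0 hψ
      refine ⟨w, hw0, hw, (mul_eq_zero.1 (left_eigenvector hY hw)).resolve_left ?_⟩
      rw [neg_add_eq_sub]
      exact sub_ne_zero.2 (he_inj.ne (Ne.symm hi))
  choose w hw0 hw hwl using hfam
  -- The row would annihilate a whole eigenbasis, but on `(1, 0, 0)` it takes the value `μ`.
  obtain ⟨c, hc⟩ := (exists_eq_sum_eigenvectors (e := fun i => -e i)
    (fun i j h => he_inj (neg_injective h)) hw0 hw).2 ![1, 0, 0]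
  have c0 := congrFun hc 0
  have c1 := congrFun hc 1
  have c2 := congrFun hc 2
  simp [Fin.sum_univ_three] at c0 c1 c2
  apply hμ
  linear_combination -μ * c0 + Y₂ * c1 - Y₁ * c2 + c 0 * hwl 0 + c 1 * hwl 1 + c 2 * hwl 2

theorem vmax_intertwiner_of_hasCoords (he : ∀ i, OnCurve l h₁ h₂ μ (e i))
    (he_inj : Function.Injective e) (hQ : ∀ i, HasCoords (Q i) μ (e i))
    (hαβ : α ≠ β) (hαγ : α ≠ γ) (hβγ : β ≠ γ)
    (hY : (laxL l x μ).mulVec ![1, Y₁, Y₂] = e α • ![1, Y₁, Y₂]) (hψ0 : ψ ≠ 0)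
    (hψ : (laxL l x (lam l h₁ h₂)).mulVec ψ = eta l h₁ h₂ • ψ) (hP : HasCoords P a b)
    (hab : a = μ ∧ (∃ i, b = e i) ∨ a = -μ ∧ (∃ i, b = -e i)) :
    vmax P.v ((intertwiner μ Y₁ Y₂ (lam l h₁ h₂)).mulVec ψ) =
      exp (-vanishingOrder μ (e α) (e β) (e γ) a b) * vmax P.v ψ := by
  have hc : OnCurve l h₁ h₂ a b := by
    rcases hab with ⟨rfl, i, rfl⟩ | ⟨rfl, i, rfl⟩
    exacts [he i, (he i).neg]
  have hb : 3 * b ^ 2 - l ^ 2 ≠ 0 := by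
    rcases hab with ⟨-, i, rfl⟩ | ⟨-, i, rfl⟩
    · exact unramified_of_injective he he_inj i
    · simpa using unramified_of_injective he he_inj i
  obtain ⟨c, hc0, hφ⟩ := exists_normalized P.v hψ0
  have hLφ : (laxL l x (lam l h₁ h₂)).mulVec (c • ψ) = eta l h₁ h₂ • (c • ψ) := by
    rw [Matrix.mulVec_smul, hψ, smul_comm]
  obtain ⟨u, hu0, hu, hLu⟩ := exists_res_eigenvector hP hc hb hφ hLφ
  -- Both sides scale alike, so `ψ` may be replaced by its normalized multiple.
  suffices h : vmax P.v ((intertwiner μ Y₁ Y₂ (lam l h₁ h₂)).mulVec (c • ψ)) =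
      exp (-vanishingOrder μ (e α) (e β) (e γ) a b) by
    rw [Matrix.mulVec_smul, vmax_smul] at h
    rw [vmax_smul] at hφ
    rw [← h, mul_right_comm, hφ, one_mul]
  have hAB := he_inj.ne hαβ
  have hAC := he_inj.ne hαγ
  have hBC := he_inj.ne hβγ
  rcases eq_or_ne μ 0 with rfl | hμ
  -- Over `λ = 0` the sum and product of the three values vanish, so they are `0` and an opposite
  -- pair. The fibre is stable under `υ`, and the cases depend on whether `η_α` is the zero value.
  · obtain ⟨hs, hp, hr⟩ := vieta (he α) (he β) (he γ) hAB hAC hBC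
    have hr0 : e α * e β * e γ = 0 := by rw [hr]; simp [rhs]
    obtain rfl : a = 0 := by rcases hab with h | h <;> simpa using h.1
    have hroot : (b - e α) * (b - e β) * (b - e γ) = 0 := by
      have hb3 : b ^ 3 - l ^ 2 * b = 0 := by
        unfold OnCurve at hc
        linear_combination hc
      linear_combination hb3 - b ^ 2 * hs + b * hp - hr0
    rcases eq_or_ne (e α) 0 with hA | hA
    · have hl : l ≠ 0 := by
        rintro rfl
        rw [hA] at hp
        have : e β * e γ = 0 := by linear_combination hp
        rcases mul_eq_zero.1 this with h | h
        · exact hAB (hA.trans h.symm)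
        · exact hAC (hA.trans h.symm)
      rw [hA] at hY
      rw [vmax_intertwiner_zero_zero hP hc hb hl hφ hY]
      congr 2
      have hC : e γ = -e β := by rw [hA] at hs; linear_combination hs
      have hB : e β ≠ 0 := fun h => hAB (hA.trans h.symm)
      have hBB : e β ≠ -e β := fun h => hBC (h.trans hC.symm)
      rw [hA, hC] at hroot
      simp only [sub_zero, sub_neg_eq_add, mul_eq_zero] at hroot
      rcases hroot with (rfl | hb) | hb
      · simp [vanishingOrder, hA, hC, hB, hB.symm]
      · obtain rfl : b = e β := sub_eq_zero.1 hb
        simp [vanishingOrder, hA, hC, hB, hBB]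
      · obtain rfl : b = -e β := eq_neg_of_add_eq_zero_left hb
        simp [vanishingOrder, hA, hC, hB, hBB.symm]
    · have hA2 : e α ≠ -e α := fun h => hA (by linear_combination h / 2)
      have hBC' : (e β = 0 ∧ e γ = -e α) ∨ (e γ = 0 ∧ e β = -e α) := by
        rcases mul_eq_zero.1 hr0 with h | h
        · have h := (mul_eq_zero.1 h).resolve_left hA
          exact Or.inl ⟨h, by rw [h] at hs; linear_combination hs⟩
        · exact Or.inr ⟨h, by rw [h] at hs; linear_combination hs⟩
      have hl : l ≠ 0 := by
        rintro rfl
        have : e α * e α = 0 := by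
          rcases hBC' with ⟨h, h'⟩ | ⟨h, h'⟩ <;> rw [h, h'] at hp <;> linear_combination -hp
        exact hA (mul_self_eq_zero.1 this)
      have hb' : b = 0 ∨ b = e α ∨ b = -e α := by
        simp only [mul_eq_zero, sub_eq_zero] at hroot
        rcases hBC' with ⟨h, h'⟩ | ⟨h, h'⟩ <;> rw [h, h'] at hroot <;> tauto
      rcases hb' with rfl | rfl | rfl
      · rw [vmax_intertwiner_zero_of_eq_zero hP hc hl hA hY hu0 hu hLu]
        congr 2
        rcases hBC' with ⟨h, h'⟩ | ⟨h, h'⟩ <;> simp [vanishingOrder, h, h', hA.symm]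
      · obtain ⟨k, hk⟩ := eq_smul_of_eigenvector he he_inj hQ hψ0 hψ hY hLu
        rw [vmax_intertwiner_zero_of_eq hP hc hb hA hY hφ hLφ hu hk]
        congr 2
        rcases hBC' with ⟨h, h'⟩ | ⟨h, h'⟩ <;> simp [vanishingOrder, h, h', hA]
      · rw [vmax_intertwiner_zero_of_eq_neg hP hA hY hu0 hu hLu, ← exp_zero]
        congr 1
        rcases hBC' with ⟨h, h'⟩ | ⟨h, h'⟩ <;>
          simp [vanishingOrder, h, h', hA, hA2.symm]
  · have hμ2 : μ ≠ -μ := fun h => hμ (by linear_combination h / 2)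
    rcases hab with ⟨rfl, i, rfl⟩ | ⟨rfl, i, rfl⟩
    · by_cases hi : i = α
      · subst hi
        obtain ⟨k, hk⟩ := eq_smul_of_eigenvector he he_inj hQ hψ0 hψ hY hLu
        rw [vmax_intertwiner_of_eq_smul hP hc hb hμ hφ hu hk]
        simp [vanishingOrder, hμ2]
      · rw [vmax_intertwiner_of_ne hP hμ hY hu0 hu hLu (he_inj.ne hi)]
        simp [vanishingOrder, hμ2, he_inj.ne hi]
    · by_cases hi : i = α
      · subst hi
        rw [vmax_intertwiner_neg_of_left_ne_zero hP hu
          (left_ne_zero he he_inj hQ hψ0 hψ hμ hY hu0 hLu)]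
        simp [vanishingOrder, hμ2.symm, hAB, hAC]
      · rw [vmax_intertwiner_neg_of_ne hP hc hb hμ hφ hu ((mul_eq_zero.1
          (left_eigenvector hY hLu)).resolve_left (by
            rw [neg_add_eq_sub]; exact sub_ne_zero.2 (he_inj.ne (Ne.symm hi))))]
        congr 2
        rcases fin_three_cases α β γ i hαβ hαγ hβγ with rfl | rfl | rfl
        · exact absurd rfl hi
        · simp [vanishingOrder, hμ2.symm, hBC]
        · simp [vanishingOrder, hμ2.symm, hBC.symm]

/-- The shift of the divisor of poles of an eigenvector by the intertwining matrix. -/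
theorem vmax_intertwiner (he : ∀ i, OnCurve l h₁ h₂ μ (e i))
    (he_inj : Function.Injective e) (hQ : ∀ i, HasCoords (Q i) μ (e i))
    (h_infty : IsInfinity infty) (hαβ : α ≠ β) (hαγ : α ≠ γ) (hβγ : β ≠ γ)
    (hY : (laxL l x μ).mulVec ![1, Y₁, Y₂] = e α • ![1, Y₁, Y₂]) (hψ0 : ψ ≠ 0)
    (hψ : (laxL l x (lam l h₁ h₂)).mulVec ψ = eta l h₁ h₂ • ψ) (P : Place (FunField l h₁ h₂)) :
    vmax P.v ((intertwiner μ Y₁ Y₂ (lam l h₁ h₂)).mulVec ψ) =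
      exp ((3 • pt infty - pt (Q α) - pt ((Q β).map (upsilon l h₁ h₂))
        - pt ((Q γ).map (upsilon l h₁ h₂)) : Divisor (FunField l h₁ h₂)) P) * vmax P.v ψ := by
  simp only [Finsupp.sub_apply, Finsupp.smul_apply]
  by_cases hP : IsInfinity P
  · obtain rfl := h_infty.unique hP
    have hres : ∀ a, ¬ infty.Res (lam l h₁ h₂) a := fun a h =>
      absurd h.v_le_one (not_le.2 h_infty)
    rw [pt_apply_of_not_res (hQ α) (hres _), pt_apply_of_not_res (hQ β).map_upsilon (hres _),
      pt_apply_of_not_res (hQ γ).map_upsilon (hres _), vmax_intertwiner_of_isInfinity h_infty]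
    simp [pt]
  have hle : P.v (lam l h₁ h₂) ≤ 1 := not_lt.1 hP
  rw [pt_infinity_apply h_infty hle]
  have hfinite : ∀ {a b : ℂ}, HasCoords P a b →
      (a = μ ∧ (∃ i, b = e i) ∨ a = -μ ∧ (∃ i, b = -e i)) →
      vmax P.v ((intertwiner μ Y₁ Y₂ (lam l h₁ h₂)).mulVec ψ) =
      exp (3 • 0 - pt (Q α) P - pt ((Q β).map (upsilon l h₁ h₂)) P
        - pt ((Q γ).map (upsilon l h₁ h₂)) P) * vmax P.v ψ := by
    intro a b hab h
    rw [vmax_intertwiner_of_hasCoords he he_inj hQ hαβ hαγ hβγ hY hψ0 hψ hab h]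
    rw [pt_apply_of_hasCoords (hQ α) hab (he α) (unramified_of_injective he he_inj α),
      pt_apply_of_hasCoords (hQ β).map_upsilon hab (he β).neg
        (by simpa using unramified_of_injective he he_inj β),
      pt_apply_of_hasCoords (hQ γ).map_upsilon hab (he γ).neg
        (by simpa using unramified_of_injective he he_inj γ), vanishingOrder]
    congr 2
    ring
  by_cases h1 : P.Res (lam l h₁ h₂) μ
  · rcases hasCoords_of_res_lam (he α) (he β) (he γ) (he_inj.ne hαβ) (he_inj.ne hαγ)
      (he_inj.ne hβγ) h1 with h | h | h <;> exact hfinite h (Or.inl ⟨rfl, _, rfl⟩)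
  by_cases h2 : P.Res (lam l h₁ h₂) (-μ)
  · rcases hasCoords_of_res_lam (he α).neg (he β).neg (he γ).neg
      (neg_injective.ne (he_inj.ne hαβ)) (neg_injective.ne (he_inj.ne hαγ))
      (neg_injective.ne (he_inj.ne hβγ)) h2 with h | h | h <;>
      exact hfinite h (Or.inr ⟨rfl, _, rfl⟩)
  rw [pt_apply_of_not_res (hQ α) h1, pt_apply_of_not_res (hQ β).map_upsilon h2,
    pt_apply_of_not_res (hQ γ).map_upsilon h2, vmax_intertwiner_of_v_eq_one hle]
  · simp
  · exact (P.v.map_sub_le hle (P.v_const_le _)).antisymm (not_lt.1 h1)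
  · have h3 : P.v (lam l h₁ h₂ - algebraMap ℂ _ (-μ)) = 1 :=
      (P.v.map_sub_le hle (P.v_const_le _)).antisymm (not_lt.1 h2)
    rwa [map_neg, sub_neg_eq_add] at h3

/-- The function `λ + μ` has the divisor `υ(Q₁) + υ(Q₂) + υ(Q₃) - 3∞`. -/
theorem linEquiv_fibre (he : ∀ i, OnCurve l h₁ h₂ μ (e i))
    (he_inj : Function.Injective e) (hQ : ∀ i, HasCoords (Q i) μ (e i))
    (h_infty : IsInfinity infty) (hαβ : α ≠ β) (hαγ : α ≠ γ) (hβγ : β ≠ γ) :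
    pt ((Q α).map (upsilon l h₁ h₂)) + pt ((Q β).map (upsilon l h₁ h₂)) +
      pt ((Q γ).map (upsilon l h₁ h₂)) - 3 • pt infty ∈ principal (FunField l h₁ h₂) := by
  refine ⟨lam l h₁ h₂ - algebraMap ℂ _ (-μ), lam_sub_ne_zero _, fun P => ?_⟩
  simp only [Finsupp.sub_apply, Finsupp.add_apply, Finsupp.smul_apply]
  by_cases hP : IsInfinity P
  · obtain rfl := h_infty.unique hP
    have hres : ¬ infty.Res (lam l h₁ h₂) (-μ) := fun h =>
      absurd h.v_le_one (not_le.2 h_infty)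
    rw [pt_apply_of_not_res (hQ α).map_upsilon hres, pt_apply_of_not_res (hQ β).map_upsilon hres,
      pt_apply_of_not_res (hQ γ).map_upsilon hres, infty.v.map_sub_eq_of_lt_left
        ((infty.v_const_le _).trans_lt h_infty), h_infty.v_eq_exp.1]
    simp [pt]
  have hle : P.v (lam l h₁ h₂) ≤ 1 := not_lt.1 hP
  rw [pt_infinity_apply h_infty hle]
  by_cases h2 : P.Res (lam l h₁ h₂) (-μ)
  · have hun : ∀ i, 3 * (-e i) ^ 2 - l ^ 2 ≠ 0 := fun i => by
      simpa using unramified_of_injective he he_inj i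
    have hAB := he_inj.ne hαβ
    have hAC := he_inj.ne hαγ
    have hBC := he_inj.ne hβγ
    have hval : ∀ i, HasCoords P (-μ) (-e i) → P.v (lam l h₁ h₂ - algebraMap ℂ _ (-μ)) =
        exp (-(pt ((Q α).map (upsilon l h₁ h₂)) P + pt ((Q β).map (upsilon l h₁ h₂)) P +
          pt ((Q γ).map (upsilon l h₁ h₂)) P - 3 • 0)) := by
      intro i hi
      rw [hi.v_lam_sub (he i).neg (hun i),
        pt_apply_of_hasCoords (hQ α).map_upsilon hi (he α).neg (hun α),
        pt_apply_of_hasCoords (hQ β).map_upsilon hi (he β).neg (hun β),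
        pt_apply_of_hasCoords (hQ γ).map_upsilon hi (he γ).neg (hun γ)]
      congr 2
      rcases fin_three_cases α β γ i hαβ hαγ hβγ with rfl | rfl | rfl
      · simp [hAB, hAC]
      · simp [hAB.symm, hBC]
      · simp [hAC.symm, hBC.symm]
    rcases hasCoords_of_res_lam (he α).neg (he β).neg (he γ).neg (neg_injective.ne hAB)
      (neg_injective.ne hAC) (neg_injective.ne hBC) h2 with h | h | h <;> exact hval _ h
  rw [pt_apply_of_not_res (hQ α).map_upsilon h2, pt_apply_of_not_res (hQ β).map_upsilon h2,
    pt_apply_of_not_res (hQ γ).map_upsilon h2]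
  simpa using (P.v.map_sub_le hle (P.v_const_le _)).antisymm (not_lt.1 h2)

theorem divMap_pt {F : Type*} [Field F] [Algebra ℂ F] (s : F ≃ₐ[ℂ] F) (P : Place F) :
    divMap s (pt P) = pt (P.map s) :=
  Finsupp.mapDomain_single

/-- The class of `υ(Q) - Q` lies in the Prym variety. -/
theorem cls_upsilon_sub_mem_Prym (h_infty : IsInfinity infty) (Q : Place (FunField l h₁ h₂)) :
    cls (pt (Q.map (upsilon l h₁ h₂)) - pt Q) ∈ Prym (upsilon l h₁ h₂) := by
  have hfix : infty.map (upsilon l h₁ h₂) = infty := h_infty.map_upsilon.unique h_infty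
  -- As `υ` fixes `∞`, the degree-zero divisor `∞ - Q` is sent to `υ(Q) - Q` by `1 - υ`.
  refine ⟨cls (pt infty - pt Q), ⟨pt infty - pt Q, ?_, rfl⟩, ?_⟩
  · change degree _ (pt infty - pt Q) = 0
    rw [map_sub]
    simp [degree, pt]
  · change cls (pt infty - pt Q) - cls (divMap (upsilon l h₁ h₂) (pt infty - pt Q)) = _
    rw [map_sub, divMap_pt, divMap_pt, hfix]
    change cls ((pt infty - pt Q) - (pt infty - pt (Q.map (upsilon l h₁ h₂)))) = _
    congr 1
    abel

/-- The Bäcklund transformation shifts the divisor of poles of the eigenvectors by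
`3∞ - Q_α - υ(Q_β) - υ(Q_γ)`, up to linear equivalence. -/
theorem linEquiv_of_isBacklundImage {x' : Phase} {D D' : Divisor (FunField l h₁ h₂)}
    (he : ∀ i, OnCurve l h₁ h₂ μ (e i))
    (he_inj : Function.Injective e) (hQ : ∀ i, HasCoords (Q i) μ (e i))
    (h_infty : IsInfinity infty) (hαβ : α ≠ β) (hαγ : α ≠ γ) (hβγ : β ≠ γ)
    (hx : IsBacklundImage l μ (e α) x x') (hD : IsEigenvectorDivisor x D)
    (hD' : IsEigenvectorDivisor x' D') :
    LinEquiv (D' - D) (3 • pt infty - pt (Q α) - pt ((Q β).map (upsilon l h₁ h₂))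
      - pt ((Q γ).map (upsilon l h₁ h₂))) := by
  obtain ⟨Y₁, Y₂, hY, hM⟩ := hx
  obtain ⟨ψ, hψ0, hψ, hψD⟩ := hD
  obtain ⟨ψ', hψ'0, hψ', hψD'⟩ := hD'
  have hv := vmax_intertwiner he he_inj hQ h_infty hαβ hαγ hβγ hY hψ0 hψ
  set M := intertwiner μ Y₁ Y₂ (lam l h₁ h₂)
  have hMψ0 : M.mulVec ψ ≠ 0 := by
    intro h
    have := hv infty
    rw [h, show vmax infty.v (0 : Fin 3 → FunField l h₁ h₂) = 0 by simp [vmax]] at this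
    exact mul_ne_zero exp_ne_zero (vmax_ne_zero hψ0) this.symm
  have hMψ : (laxL l x' (lam l h₁ h₂)).mulVec (M.mulVec ψ) = eta l h₁ h₂ • M.mulVec ψ := by
    rw [Matrix.mulVec_mulVec, laxL_mul_intertwiner_of_forall hM, ← Matrix.mulVec_mulVec, hψ,
      Matrix.mulVec_smul]
  obtain ⟨f, hf0, hf⟩ := exists_eq_smul_of_eigenvectors h_infty hMψ0 hψ'0 hMψ hψ'
  -- From `ψ' = f M ψ`, the poles of `f` account for the excess of `D'` over the pole divisor of `M
  -- ψ`; the sign convention for principal divisors then calls for `f⁻¹`.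
  refine ⟨f⁻¹, inv_ne_zero hf0, fun P => ?_⟩
  have h1 : vmax P.v ψ = exp (D P) := hψD P
  have h2 : vmax P.v ψ' = exp (D' P) := hψD' P
  rw [hf, vmax_smul, hv P, h1, ← exp_add] at h2
  rw [map_inv₀, exp_neg, inv_inj]
  refine mul_right_cancel₀ exp_ne_zero (h2.trans ?_)
  rw [← exp_add, Finsupp.sub_apply, Finsupp.sub_apply]
  congr 1
  ring

end Shift

end

end HenonHeiles

open HenonHeiles
theorem proposition3 (l h₁ h₂ μ : ℂ)
    -- the three distinct points `Q i = (μ, e i)` of the curve over `λ = μ`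
    (e : Fin 3 → ℂ) (he : ∀ i, OnCurve l h₁ h₂ μ (e i)) (he_inj : Function.Injective e)
    (Q : Fin 3 → Place (FunField l h₁ h₂)) (hQ : ∀ i, HasCoords (Q i) μ (e i))
    (infty : Place (FunField l h₁ h₂)) (h_infty : IsInfinity infty)
    (α β γ : Fin 3) (hαβ : α ≠ β) (hαγ : α ≠ γ) (hβγ : β ≠ γ) :
    (∀ (x x' : Phase) (D D' : Divisor (FunField l h₁ h₂)),
      H₁ l x = h₁ → H₂ l x = h₂ → IsBacklundImage l μ (e α) x x' →
      IsEigenvectorDivisor x D → IsEigenvectorDivisor x' D' →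
        LinEquiv
          (D' + pt (Q α) + pt ((Q β).map (upsilon l h₁ h₂)) + pt ((Q γ).map (upsilon l h₁ h₂)))
          (D + 3 • pt infty) ∧
        LinEquiv (D' - D)
          (3 • pt infty - pt (Q α) - pt ((Q β).map (upsilon l h₁ h₂))
            - pt ((Q γ).map (upsilon l h₁ h₂))) ∧
        LinEquiv (D' - D) (pt ((Q α).map (upsilon l h₁ h₂)) - pt (Q α)) ∧
        cls (D' - D) ∈ Prym (upsilon l h₁ h₂)) ∧
    (∃ T ∈ Prym (upsilon l h₁ h₂),
      ∀ (x x' : Phase) (D D' : Divisor (FunField l h₁ h₂)),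
        H₁ l x = h₁ → H₂ l x = h₂ → IsBacklundImage l μ (e α) x x' →
        IsEigenvectorDivisor x D → IsEigenvectorDivisor x' D' →
          cls D' = cls D + T) := by
  have hPrym := cls_upsilon_sub_mem_Prym h_infty (Q α)
  have hshift : ∀ (x x' : Phase) (D D' : Divisor (FunField l h₁ h₂)),
      IsBacklundImage l μ (e α) x x' → IsEigenvectorDivisor x D → IsEigenvectorDivisor x' D' →
      LinEquiv (D' - D) (pt ((Q α).map (upsilon l h₁ h₂)) - pt (Q α)) := by
    intro x x' D D' hx hD hD'
    have h1 := linEquiv_of_isBacklundImage he he_inj hQ h_infty hαβ hαγ hβγ hx hD hD'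
    have h2 := linEquiv_fibre he he_inj hQ h_infty hαβ hαγ hβγ
    unfold LinEquiv at h1 ⊢
    -- Subtracting the divisor of `λ + μ` cancels `υ(Q_β)`, `υ(Q_γ)` and `3∞`.
    convert sub_mem h1 h2 using 1
    abel
  have hcls : ∀ (x x' : Phase) (D D' : Divisor (FunField l h₁ h₂)),
      IsBacklundImage l μ (e α) x x' → IsEigenvectorDivisor x D → IsEigenvectorDivisor x' D' →
      cls (D' - D) = cls (pt ((Q α).map (upsilon l h₁ h₂)) - pt (Q α)) := by
    intro x x' D D' hx hD hD'
    exact (QuotientAddGroup.eq_iff_sub_mem).2 (hshift x x' D D' hx hD hD')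
  refine ⟨fun x x' D D' _ _ hx hD hD' => ?_, _, hPrym, fun x x' D D' _ _ hx hD hD' => ?_⟩
  · have h1 := linEquiv_of_isBacklundImage he he_inj hQ h_infty hαβ hαγ hβγ hx hD hD'
    refine ⟨?_, h1, hshift x x' D D' hx hD hD', ?_⟩
    · unfold LinEquiv at h1 ⊢
      convert h1 using 1
      abel
    · rw [hcls x x' D D' hx hD hD']
      exact hPrym
  · rw [← hcls x x' D D' hx hD hD']
    change cls D' = cls (D + (D' - D))
    rw [add_sub_cancel]
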